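/- Let $p,q\ge 0$ be integers and $\mu>0$ a real number. Let $Z$ be the (open) set of complex $(p+q)\times p$ matrices $z=(z^A_i)$ of rank $p$, and let $C^\infty(Z)$ be the algebra of smooth complex-valued functions on $Z$. On $C^\infty(Z)[[\lambda]]$ let $\star$ be the Wick star product, the $\mathbb C[[\lambda]]$-bilinear product with $$f\star g=\sum_{r\ge0}\frac{\lambda^r}{r!}\sum_{A_1,i_1,\dots,A_r,i_r}\frac{\partial^r f}{\partial z^{A_1}_{i_1}\cdots\partial z^{A_r}_{i_r}}\,\frac{\partial^r g}{\partial \bar z^{A_1}_{i_1}\cdots\partial \bar z^{A_r}_{i_r}}\qquad(f,g\in C^\infty(Z)).$$ Let $C_0^\infty[[\lambda]]$ be the space of formal power series whose coefficients are smooth functions $f$ with $f(zU)=f(z)$ for all $U\in U(p)$ (invariant functions), and $C_{hom}^\infty[[\lambda]]$ the space of those whose coefficients are smooth and satisfy $f(zg)=f(z)$ for all $g\in GL(p,\mathbb C)$ (homogeneous functions). Put $x=z^\dagger z$, and write $x-\mu$ for $x-\mu\mathbf 1$. Let $$\mathcal J=\Big\{\textstyle\sum_{i,j}G_{ij}\star(x-\mu)_{ji}\Big\},$$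 where $G$ runs over the formal power series in $\lambda$ of smooth functions $Z\to\mathfrak{gl}(p,\mathbb C)=\mathfrak u(p)\otimes\mathbb C$ that are equivariant, $G(zU)=U^{-1}G(z)U$ for all $U\in U(p)$. Then: 1. $C_0^\infty[[\lambda]]$ is closed under $\star$, $\mathcal J\subseteq C_0^\infty[[\lambda]]$, and $\mathcal J$ is a two-sided ideal of $(C_0^\infty[[\lambda]],\star)$. 2. $C_0^\infty[[\lambda]]=C_{hom}^\infty[[\lambda]]\oplus\mathcal J$, that is, every invariant series is in exactly one way the sum of a homogeneous series and an element of $\mathcal J$. 3. Consequently there is exactly one $\mathbb C[[\lambda]]$-linear map $P:C_0^\infty[[\lambda]]\to C_{hom}^\infty[[\lambda]]$ that is the identity on $C_{hom}^\infty[[\lambda]]$ and has kernel $\mathcal J$; in particular the kernel of this projection is a two-sided $\star$-ideal. -/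

import Mathlib

open scoped ContDiff Matrix PowerSeries
open Finset.HasAntidiagonal (antidiagonal)

noncomputable section

namespace WickGrassmann

/-! ### The manifold of full rank matrices and its smooth functions -/

/-- The real normed space of all complex `(p+q) × p` matrices. The type synonym `Matrix` carries no
norm in Mathlib, so the analysis is done on the underlying space of families of entries;
`Matrix.of` turns such a family into a matrix. -/
abbrev Mat (p q : ℕ) : Type := Fin (p + q) → Fin p → ℂ

/-- The complex `(p+q) × p` matrices of rank `p`. -/
def FullRank (p q : ℕ) : Set (Mat p q) :=
  {z | (Matrix.of z).rank = p}

theorem isOpen_fullRank (p q : ℕ) : IsOpen (FullRank p q) := by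
  have h : FullRank p q = {z | ((Matrix.of z)ᴴ * Matrix.of z).det ≠ 0} := by
    ext z'
    set z := Matrix.of z' with hzz
    have h1 : (zᴴ * z).rank = z.rank := by
      open scoped ComplexOrder in exact Matrix.rank_conjTranspose_mul_self z
    show z.rank = p ↔ (zᴴ * z).det ≠ 0
    constructor
    · intro hz h0
      have hz' : (zᴴ * z).rank = p := h1.trans hz
      obtain ⟨v, hv, hv0⟩ := Matrix.exists_mulVec_eq_zero_iff.mpr h0
      have h2 := LinearMap.finrank_range_add_finrank_ker (zᴴ * z).mulVecLin
      have h3 : Module.finrank ℂ (LinearMap.range (zᴴ * z).mulVecLin) = p := hz'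
      have h4 : Module.finrank ℂ (LinearMap.ker (zᴴ * z).mulVecLin) = 0 := by
        simp only [h3, Module.finrank_fin_fun] at h2
        omega
      have h5 := Submodule.finrank_eq_zero.mp h4
      have h6 : v ∈ LinearMap.ker (zᴴ * z).mulVecLin := by simpa using hv0
      rw [h5] at h6
      exact hv (by simpa using h6)
    · intro hz
      have h2 : IsUnit (zᴴ * z) := by
        rw [Matrix.isUnit_iff_isUnit_det]
        exact isUnit_iff_ne_zero.mpr hz
      have h3 := Matrix.rank_of_isUnit _ h2
      rw [h1] at h3
      simpa using h3
  rw [h]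
  refine isOpen_ne_fun (Continuous.matrix_det ?_) continuous_const
  have hc : Continuous fun z : Mat p q => Matrix.of z := continuous_id
  exact hc.matrix_conjTranspose.matrix_mul hc

/-- A function on the full rank matrices, extended by zero to all matrices. Only its germs at full
rank matrices, which form an open set, are ever used. -/
def zeroExt {p q : ℕ} (f : FullRank p q → ℂ) : Mat p q → ℂ :=
  Function.extend Subtype.val f 0

theorem zeroExt_apply {p q : ℕ} (f : FullRank p q → ℂ) (z : FullRank p q) :
    zeroExt f z.1 = f z :=
  Subtype.val_injective.extend_apply f 0 z

theorem contDiffOn_zeroExt_iff {p q : ℕ} {f : FullRank p q → ℂ}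
    {g : Mat p q → ℂ} (h : ∀ z : FullRank p q, f z = g z.1) :
    ContDiffOn ℝ ∞ (zeroExt f) (FullRank p q) ↔ ContDiffOn ℝ ∞ g (FullRank p q) :=
  contDiffOn_congr fun z hz => (zeroExt_apply f ⟨z, hz⟩).trans (h ⟨z, hz⟩)

/-- The algebra of smooth (in the real sense) complex-valued functions on the full rank matrices. -/
def SmoothFun (p q : ℕ) : Subalgebra ℂ (FullRank p q → ℂ) where
  carrier := {f | ContDiffOn ℝ ∞ (zeroExt f) (FullRank p q)}
  mul_mem' {f g} hf hg :=
    (contDiffOn_zeroExt_iff (g := fun z => zeroExt f z * zeroExt g z)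
      fun z => by simp [zeroExt_apply]).mpr (ContDiffOn.mul hf hg)
  add_mem' {f g} hf hg :=
    (contDiffOn_zeroExt_iff (g := fun z => zeroExt f z + zeroExt g z)
      fun z => by simp [zeroExt_apply]).mpr (ContDiffOn.add hf hg)
  algebraMap_mem' c :=
    (contDiffOn_zeroExt_iff (g := fun _ => c) fun z => by simp).mpr contDiffOn_const

/-- The real directional derivative of a smooth function on the full rank matrices. -/
def dirDeriv {p q : ℕ} (v : Mat p q) :
    SmoothFun p q →ₗ[ℂ] SmoothFun p q where
  toFun f := ⟨fun z => fderiv ℝ (zeroExt f.1) z.1 v,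
    (contDiffOn_zeroExt_iff (g := fun z => fderiv ℝ (zeroExt f.1) z v) fun _ => rfl).mpr
      ((f.2.fderiv_of_isOpen (isOpen_fullRank p q) (m := ∞) (by simp)).clm_apply
        contDiffOn_const)⟩
  map_add' f g := by
    ext z
    have hn := (isOpen_fullRank p q).mem_nhds z.2
    have hf := (f.2.contDiffAt hn).differentiableAt (by simp)
    have hg := (g.2.contDiffAt hn).differentiableAt (by simp)
    have h : zeroExt (f + g).1 =ᶠ[nhds z.1] zeroExt f.1 + zeroExt g.1 := by
      filter_upwards [hn] with w hw
      have e := fun k : FullRank p q → ℂ => zeroExt_apply k ⟨w, hw⟩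
      simp only at e
      simp [e]
    show fderiv ℝ (zeroExt (f + g).1) z.1 v =
      fderiv ℝ (zeroExt f.1) z.1 v + fderiv ℝ (zeroExt g.1) z.1 v
    rw [h.fderiv_eq, fderiv_add hf hg]
    rfl
  map_smul' c f := by
    ext z
    have hn := (isOpen_fullRank p q).mem_nhds z.2
    have hf := (f.2.contDiffAt hn).differentiableAt (by simp)
    have h : zeroExt (c • f).1 =ᶠ[nhds z.1] fun w => c • zeroExt f.1 w := by
      filter_upwards [hn] with w hw
      have e := fun k : FullRank p q → ℂ => zeroExt_apply k ⟨w, hw⟩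
      simp only at e
      simp [e]
    show fderiv ℝ (zeroExt (c • f).1) z.1 v = c • fderiv ℝ (zeroExt f.1) z.1 v
    rw [h.fderiv_eq, fderiv_fun_const_smul hf]
    rfl

/-- The matrix whose only nonzero entry is `c`, at the place `(A, i)`. -/
def matUnit {p q : ℕ} (A : Fin (p + q)) (i : Fin p) (c : ℂ) : Mat p q :=
  Matrix.of.symm (Matrix.single A i c)

/-- The Wirtinger derivative `∂/∂z^A_i = (∂/∂ Re z^A_i - i ∂/∂ Im z^A_i) / 2`. -/
def dz {p q : ℕ} (A : Fin (p + q)) (i : Fin p) : SmoothFun p q →ₗ[ℂ] SmoothFun p q :=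
  (1 / 2 : ℂ) • (dirDeriv (matUnit A i 1)
    - Complex.I • dirDeriv (matUnit A i Complex.I))

/-- The Wirtinger derivative `∂/∂z̄^A_i = (∂/∂ Re z^A_i + i ∂/∂ Im z^A_i) / 2`, which is the
derivative with respect to the entry `(z†)^i_A` of the adjoint matrix. -/
def dzbar {p q : ℕ} (A : Fin (p + q)) (i : Fin p) : SmoothFun p q →ₗ[ℂ] SmoothFun p q :=
  (1 / 2 : ℂ) • (dirDeriv (matUnit A i 1)
    + Complex.I • dirDeriv (matUnit A i Complex.I))

/-! ### The Wick star product -/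

/-- The bidifferential operator `m ∘ (∑ A i, ∂/∂z^A_i ⊗ ∂/∂z̄^A_i)^r`, that is,
`(f, g) ↦ ∑ (∂^r f / ∂z^{A₁}_{i₁} ⋯ ∂z^{A_r}_{i_r}) (∂^r g / ∂z̄^{A₁}_{i₁} ⋯ ∂z̄^{A_r}_{i_r})`. -/
def wickTerm {p q : ℕ} : ℕ → SmoothFun p q →ₗ[ℂ] SmoothFun p q →ₗ[ℂ] SmoothFun p q
  | 0 => LinearMap.mul ℂ (SmoothFun p q)
  | r + 1 => ∑ A : Fin (p + q), ∑ i : Fin p, (wickTerm r).compl₁₂ (dz A i) (dzbar A i)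

/-- Formal power series in `λ` (the variable `PowerSeries.X`) of smooth functions. -/
abbrev Series (p q : ℕ) : Type := PowerSeries (SmoothFun p q)

theorem coeff_smul_series {p q : ℕ} (c : ℂ⟦X⟧) (F : Series p q) (n : ℕ) :
    PowerSeries.coeff n (c • F) =
      ∑ x ∈ antidiagonal n, PowerSeries.coeff x.1 c • PowerSeries.coeff x.2 F := by
  rw [Algebra.smul_def, PowerSeries.algebraMap_apply'', PowerSeries.coeff_mul]
  simp [Algebra.smul_def]

theorem sum_antidiagonal_assoc {M : Type*} [AddCommMonoid M] (f : ℕ → ℕ → ℕ → M) (n : ℕ) :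
    ∑ x ∈ antidiagonal n, ∑ y ∈ antidiagonal x.1, f y.1 y.2 x.2 =
      ∑ x ∈ antidiagonal n, ∑ y ∈ antidiagonal x.2, f x.1 y.1 y.2 := by
  simp only [Finset.sum_sigma']
  refine Finset.sum_nbij' (fun a => ⟨(a.2.1, a.2.2 + a.1.2), (a.2.2, a.1.2)⟩)
    (fun a => ⟨(a.1.1 + a.2.1, a.2.2), (a.1.1, a.2.1)⟩) ?_ ?_ ?_ ?_ ?_ <;>
  · rintro ⟨⟨a, b⟩, ⟨c, d⟩⟩ h
    simp only [Finset.mem_sigma, Finset.HasAntidiagonal.mem_antidiagonal] at h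
    obtain ⟨h1, h2⟩ := h
    subst h1 h2
    simp [add_assoc]

theorem sum_antidiagonal_left_comm {M : Type*} [AddCommMonoid M] (f : ℕ → ℕ → ℕ → M) (n : ℕ) :
    ∑ x ∈ antidiagonal n, ∑ y ∈ antidiagonal x.2, f x.1 y.1 y.2 =
      ∑ x ∈ antidiagonal n, ∑ y ∈ antidiagonal x.2, f y.1 x.1 y.2 := by
  rw [← sum_antidiagonal_assoc, ← sum_antidiagonal_assoc (fun a b c => f b a c)]
  exact Finset.sum_congr rfl fun x _ =>
    (Finset.Nat.sum_antidiagonal_swap (f := fun y => f y.1 y.2 x.2)).symm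

/-- The formal series underlying the Wick star product: the coefficient of `λ^n` in `F ⋆ G` is
`∑_{k + r + l = n} (1 / r!) wickTerm r F_k G_l`. -/
def wickSeries {p q : ℕ} (F G : Series p q) : Series p q :=
  PowerSeries.mk fun n => ∑ x ∈ antidiagonal n, ∑ y ∈ antidiagonal x.2,
    ((y.1.factorial : ℂ)⁻¹) • wickTerm y.1 (PowerSeries.coeff x.1 F) (PowerSeries.coeff y.2 G)

/-- The Wick star product `F ⋆ G = ∑_r (λ^r / r!) wickTerm r F G`, extended `ℂ⟦λ⟧`-bilinearly to
formal power series. -/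
def wick {p q : ℕ} : Series p q →ₗ[ℂ⟦X⟧] Series p q →ₗ[ℂ⟦X⟧] Series p q :=
  LinearMap.mk₂ ℂ⟦X⟧ wickSeries
    (fun F F' G => by
      ext1 n
      simp [wickSeries, Finset.sum_add_distrib])
    (fun c F G => by
      ext1 n
      simp only [wickSeries, PowerSeries.coeff_mk, coeff_smul_series, map_sum, map_smul,
        LinearMap.sum_apply, LinearMap.smul_apply, Finset.smul_sum]
      have h := sum_antidiagonal_assoc (fun a b m => ∑ y ∈ antidiagonal m,
        PowerSeries.coeff a c • ((y.1.factorial : ℂ)⁻¹) •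
          wickTerm y.1 (PowerSeries.coeff b F) (PowerSeries.coeff y.2 G)) n
      rw [← h]
      refine Finset.sum_congr rfl fun x _ => ?_
      rw [Finset.sum_comm]
      simp only [smul_comm (PowerSeries.coeff _ c)])
    (fun F G G' => by
      ext1 n
      simp [wickSeries, Finset.sum_add_distrib])
    (fun c F G => by
      ext1 n
      simp only [wickSeries, PowerSeries.coeff_mk, coeff_smul_series, map_sum, map_smul,
        Finset.smul_sum]
      have h1 := fun (k m : ℕ) => sum_antidiagonal_left_comm (fun r a l =>
        ((r.factorial : ℂ)⁻¹) • PowerSeries.coeff a c •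
          wickTerm r (PowerSeries.coeff k F) (PowerSeries.coeff l G)) m
      simp only [h1]
      rw [sum_antidiagonal_left_comm (fun k a m => ∑ y ∈ antidiagonal m,
        ((y.1.factorial : ℂ)⁻¹) • PowerSeries.coeff a c •
          wickTerm y.1 (PowerSeries.coeff k F) (PowerSeries.coeff y.2 G)) n]
      simp only [smul_comm (PowerSeries.coeff _ c)])

/-! ### Group actions, invariant and homogeneous functions -/

/-- The right action `z ↦ z g` of `GL(p, ℂ)`. -/
def act {p q : ℕ} (z : FullRank p q) (g : GL (Fin p) ℂ) : FullRank p q :=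
  ⟨Matrix.of.symm (Matrix.of z.1 * g.1), (Matrix.rank_mul_eq_left_of_isUnit_det g.1 (Matrix.of z.1)
    ((Matrix.isUnit_iff_isUnit_det _).mp g.isUnit)).trans z.2⟩

/-- Formal power series all of whose coefficients lie in a given subspace. -/
def seriesIn {p q : ℕ} (N : Submodule ℂ (SmoothFun p q)) : Submodule ℂ⟦X⟧ (Series p q) where
  carrier := {F | ∀ n, PowerSeries.coeff n F ∈ N}
  add_mem' hF hG n := by simpa using N.add_mem (hF n) (hG n)
  zero_mem' n := by simp
  smul_mem' c F hF n := by
    rw [coeff_smul_series]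
    exact N.sum_mem fun x _ => N.smul_mem _ (hF x.2)

/-- The `U(p)`-invariant smooth functions. -/
def invariantFun (p q : ℕ) : Submodule ℂ (SmoothFun p q) where
  carrier := {f | ∀ (U : Matrix.unitaryGroup (Fin p) ℂ) (z : FullRank p q),
    f.1 (act z (Unitary.toUnits U)) = f.1 z}
  add_mem' hf hg U z := congrArg₂ (· + ·) (hf U z) (hg U z)
  zero_mem' _ _ := rfl
  smul_mem' c _ hf U z := congrArg (c * ·) (hf U z)

/-- The homogeneous functions: the `GL(p, ℂ)`-invariant smooth functions. -/
def homogeneousFun (p q : ℕ) : Submodule ℂ (SmoothFun p q) where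
  carrier := {f | ∀ (g : GL (Fin p) ℂ) (z : FullRank p q), f.1 (act z g) = f.1 z}
  add_mem' hf hg U z := congrArg₂ (· + ·) (hf U z) (hg U z)
  zero_mem' _ _ := rfl
  smul_mem' c _ hf U z := congrArg (c * ·) (hf U z)

/-- The space `C_0^∞⟦λ⟧` of formal power series of `U(p)`-invariant functions. -/
def Inv (p q : ℕ) : Submodule ℂ⟦X⟧ (Series p q) := seriesIn (invariantFun p q)

/-- The space `C_hom^∞⟦λ⟧` of formal power series of homogeneous functions. -/
def Hom (p q : ℕ) : Submodule ℂ⟦X⟧ (Series p q) := seriesIn (homogeneousFun p q)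

/-! ### Equivariant matrix functions and the star ideal -/

/-- The value at `z` of the coefficient of `λ^n` of a matrix of formal power series. -/
def coeffAt {p q : ℕ} (n : ℕ) (z : FullRank p q) (G : Matrix (Fin p) (Fin p) (Series p q)) :
    Matrix (Fin p) (Fin p) ℂ :=
  Matrix.of fun i j => (PowerSeries.coeff n (G i j)).1 z

/-- Formal power series of smooth `U(p)`-equivariant functions `G(zU) = U⁻¹ G(z) U` with values in
`gl(p, ℂ) = u(p) ⊗ ℂ`. -/
def Equivariant (p q : ℕ) : Submodule ℂ⟦X⟧ (Matrix (Fin p) (Fin p) (Series p q)) where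
  carrier := {G | ∀ (n : ℕ) (U : Matrix.unitaryGroup (Fin p) ℂ) (z : FullRank p q),
    coeffAt n (act z (Unitary.toUnits U)) G =
      (U⁻¹ : Matrix.unitaryGroup (Fin p) ℂ).1 * coeffAt n z G * U.1}
  add_mem' {G G'} hG hG' n U z := by
    have h : ∀ w : FullRank p q, coeffAt n w (G + G') = coeffAt n w G + coeffAt n w G' :=
      fun w => by ext i j; simp [coeffAt]
    rw [h, h, hG, hG', Matrix.mul_add, Matrix.add_mul]
  zero_mem' n U z := by
    have h : ∀ w : FullRank p q, coeffAt n w 0 = 0 := fun w => by ext i j; simp [coeffAt]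
    rw [h, h]
    simp
  smul_mem' c G hG n U z := by
    have h : ∀ w : FullRank p q, coeffAt n w (c • G) =
        ∑ x ∈ antidiagonal n, PowerSeries.coeff x.1 c • coeffAt x.2 w G := fun w => by
      ext i j
      simp [coeffAt, coeff_smul_series, Matrix.sum_apply]
    rw [h, h, Finset.mul_sum, Finset.sum_mul]
    refine Finset.sum_congr rfl fun x _ => ?_
    rw [hG, Matrix.mul_smul, Matrix.smul_mul]

/-- The matrix `x = z† z` of smooth functions. -/
def xFun (p q : ℕ) : Matrix (Fin p) (Fin p) (SmoothFun p q) :=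
  Matrix.of fun i j => ⟨fun z => ((Matrix.of z.1)ᴴ * Matrix.of z.1) i j, by
    refine (contDiffOn_zeroExt_iff (g := fun z => ((Matrix.of z)ᴴ * Matrix.of z) i j) fun _ => rfl).mpr ?_
    have h : ∀ A k, ContDiff ℝ ∞ fun z : Mat p q => z A k :=
      fun A k => contDiff_apply_apply ℝ ℂ A k
    simp only [Matrix.mul_apply, Matrix.conjTranspose_apply]
    refine (ContDiff.sum fun A _ => ContDiff.mul ?_ (h A j)).contDiffOn
    exact Complex.conjCLE.contDiff.comp (h A i)⟩

/-- The matrix `x - μ`, with `μ` standing for `μ` times the unit matrix. -/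
def xSub (p q : ℕ) (μ : ℝ) : Matrix (Fin p) (Fin p) (SmoothFun p q) :=
  xFun p q - Matrix.scalar (Fin p) (algebraMap ℂ (SmoothFun p q) (μ : ℂ))

/-- The pairing `G ↦ ⟨G ⋆, x - μ⟩ = ∑_{i,j} G^i_j ⋆ (x - μ)^j_i`. -/
def pairing (p q : ℕ) (μ : ℝ) :
    Matrix (Fin p) (Fin p) (Series p q) →ₗ[ℂ⟦X⟧] Series p q where
  toFun G := ∑ i, ∑ j, wick (G i j) (PowerSeries.C (xSub p q μ j i))
  map_add' G G' := by simp [Finset.sum_add_distrib]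
  map_smul' c G := by simp [Finset.smul_sum]

/-- The star ideal `⟨x - μ⟩_⋆ = {⟨G ⋆, x - μ⟩ | G equivariant}`. -/
def starIdeal (p q : ℕ) (μ : ℝ) : Submodule ℂ⟦X⟧ (Series p q) :=
  (Equivariant p q).map (pairing p q μ)

end WickGrassmann

end

/-!
The star ideal is two-sided because the functions `(x - μ)_{ji}` commute, for the star product, with
every invariant series. Star multiplication by `(x - μ)_{ji}` from the right is pointwise
multiplication plus `λ` times the vector field `∑_A z^A_i ∂/∂z^A_j`; from the left, the conjugate
vector field `∑_A z̄^A_j ∂/∂z̄^A_i` appears. The unitary group acts trivially on an invariant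
function, hence so does its Lie algebra `u(p)`, and since `gl(p, ℂ)` is the complexification of
`u(p)`, the two vector fields agree on invariant functions (`euler_eq_eulerBar`). The rest is
`U(p)`-equivariance of the star product (`wick_pullSeries`) and its associativity (`wick_assoc`):
the contractions `∑ ∂/∂z ⊗ ∂/∂z̄` acting on three factors commute, and both ways of bracketing give
the divided powers of their sum.

*Every invariant series is the sum of a homogeneous series and an element of the ideal.* For an
invariant function `f`, the matrix `s = √μ x^{-1/2}` moves `z` to the point `z s` of the level set
`x = μ`, and `z ↦ f (z s)` is homogeneous (`homogenize_mem`). Integrating the derivative of `f`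
along the segment from `z s` to `z` writes the difference as `∑ G_{ij} (x - μ)_{ji}` with `G`
equivariant, as the velocity `z (1 - s)` equals `z (1 + s)⁻¹ x⁻¹ (x - μ)`
(`sub_homogenize`, `pull_divide`). The pairing of `G` with `x - μ` for the star product differs from
this by a term of first order in `λ`, which is again an invariant function, so the decomposition of
a series is built order by order (`Hom_sup_starIdeal`).

*The sum is direct.* Freezing `z̄` and taking Taylor expansions in the variables `y = x - μ` along
the complexified fibre through a point of the level set `x = μ` sends homogeneous functions to
constants, and star multiplication by `(x - μ)_{ji}` to the operator
`y_{ji} + λ ∑_k x_{ki} ∂/∂x_{kj}` on formal power series. These operators satisfy the commutation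
relations of `gl(p)` up to a factor `λ`, while their leading parts are the variables, whose Koszul
complex is exact in degree one. Therefore the sum of their ranges is saturated: if it contains
`λ F`, then it contains `F` (`mem_starRange_of_shift_mem`). An element of this sum vanishes at
the origin in lowest order, so by induction it is zero as soon as it is a series of constants
(`eq_zero_of_constJet_mem_starRange`). Thus a homogeneous series in the star ideal vanishes on
the level set, which every orbit of `GL(p, ℂ)` meets (`disjoint_Hom_starIdeal`).
-/

noncomputable section

namespace WickGrassmann

/-! ### Wirtinger calculus on the full rank matrices -/

section Calculus

variable {p q : ℕ}

theorem fullRank_mem_nhds (z : FullRank p q) : FullRank p q ∈ nhds z.1 :=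
  (isOpen_fullRank p q).mem_nhds z.2

theorem contDiffAt_zeroExt (f : SmoothFun p q) (z : FullRank p q) :
    ContDiffAt ℝ ∞ (zeroExt f.1) z.1 :=
  f.2.contDiffAt (fullRank_mem_nhds z)

theorem differentiableAt_zeroExt (f : SmoothFun p q) (z : FullRank p q) :
    DifferentiableAt ℝ (zeroExt f.1) z.1 :=
  (contDiffAt_zeroExt f z).differentiableAt (by simp)

theorem zeroExt_eventuallyEq {f : FullRank p q → ℂ} {g : Mat p q → ℂ} (z : FullRank p q)
    (h : ∀ w : FullRank p q, f w = g w.1) : zeroExt f =ᶠ[nhds z.1] g := by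
  filter_upwards [fullRank_mem_nhds z] with w hw
  exact (zeroExt_apply f ⟨w, hw⟩).trans (h ⟨w, hw⟩)

theorem dirDeriv_apply (v : Mat p q) (f : SmoothFun p q) (z : FullRank p q) :
    (dirDeriv v f).1 z = fderiv ℝ (zeroExt f.1) z.1 v := rfl

theorem dirDeriv_eq_of_eq (v : Mat p q) (f : SmoothFun p q) {g : Mat p q → ℂ}
    (h : ∀ w : FullRank p q, f.1 w = g w.1) (z : FullRank p q) :
    (dirDeriv v f).1 z = fderiv ℝ g z.1 v := by
  rw [dirDeriv_apply, (zeroExt_eventuallyEq z h).fderiv_eq]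

theorem dirDeriv_mul (v : Mat p q) (f g : SmoothFun p q) :
    dirDeriv v (f * g) = dirDeriv v f * g + f * dirDeriv v g := by
  ext z
  rw [dirDeriv_eq_of_eq v (f * g) (g := fun w => zeroExt f.1 w * zeroExt g.1 w)
    (fun w => by simp [zeroExt_apply]),
    fderiv_fun_mul (differentiableAt_zeroExt f z) (differentiableAt_zeroExt g z)]
  simp [zeroExt_apply, dirDeriv_apply]
  ring

theorem dirDeriv_comm (v w : Mat p q) (f : SmoothFun p q) :
    dirDeriv v (dirDeriv w f) = dirDeriv w (dirDeriv v f) := by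
  ext z
  have hd : DifferentiableAt ℝ (fderiv ℝ (zeroExt f.1)) z.1 :=
    ((contDiffAt_zeroExt f z).fderiv_right (m := 1) (by norm_cast)).differentiableAt (by simp)
  have key : ∀ a b : Mat p q, (dirDeriv a (dirDeriv b f)).1 z =
      fderiv ℝ (fderiv ℝ (zeroExt f.1)) z.1 a b := fun a b => by
    rw [dirDeriv_eq_of_eq a (dirDeriv b f) (g := fun w => fderiv ℝ (zeroExt f.1) w b)
      (fun w => rfl), fderiv_clm_apply hd (differentiableAt_const _)]
    simp
  rw [key, key]
  exact (contDiffAt_zeroExt f z).isSymmSndFDerivAt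
    (by simpa using WithTop.coe_le_coe.mpr (le_top (a := (2 : ℕ∞)))) v w

theorem dz_apply (A : Fin (p + q)) (i : Fin p) (f : SmoothFun p q) :
    dz A i f = (1 / 2 : ℂ) • (dirDeriv (matUnit A i 1) f
      - Complex.I • dirDeriv (matUnit A i Complex.I) f) := rfl

theorem dzbar_apply (A : Fin (p + q)) (i : Fin p) (f : SmoothFun p q) :
    dzbar A i f = (1 / 2 : ℂ) • (dirDeriv (matUnit A i 1) f
      + Complex.I • dirDeriv (matUnit A i Complex.I) f) := rfl

theorem dz_mul (A : Fin (p + q)) (i : Fin p) (f g : SmoothFun p q) :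
    dz A i (f * g) = dz A i f * g + f * dz A i g := by
  simp only [dz_apply, dirDeriv_mul, Algebra.smul_def]
  ring

theorem dzbar_mul (A : Fin (p + q)) (i : Fin p) (f g : SmoothFun p q) :
    dzbar A i (f * g) = dzbar A i f * g + f * dzbar A i g := by
  simp only [dzbar_apply, dirDeriv_mul, Algebra.smul_def]
  ring

theorem dz_dz_comm (A B : Fin (p + q)) (i j : Fin p) (f : SmoothFun p q) :
    dz A i (dz B j f) = dz B j (dz A i f) := by
  simp only [dz_apply, map_smul, map_sub,
    fun v => dirDeriv_comm (matUnit A i v) (matUnit B j 1),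
    fun v => dirDeriv_comm (matUnit A i v) (matUnit B j Complex.I)]
  simp only [Algebra.smul_def]
  ring

theorem dz_dzbar_comm (A B : Fin (p + q)) (i j : Fin p) (f : SmoothFun p q) :
    dz A i (dzbar B j f) = dzbar B j (dz A i f) := by
  simp only [dz_apply, dzbar_apply, map_smul,
    map_sub, map_add,
    fun v => dirDeriv_comm (matUnit A i v) (matUnit B j 1),
    fun v => dirDeriv_comm (matUnit A i v) (matUnit B j Complex.I)]
  simp only [Algebra.smul_def]
  ring

theorem dzbar_dzbar_comm (A B : Fin (p + q)) (i j : Fin p) (f : SmoothFun p q) :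
    dzbar A i (dzbar B j f) = dzbar B j (dzbar A i f) := by
  simp only [dzbar_apply, map_smul, map_add,
    fun v => dirDeriv_comm (matUnit A i v) (matUnit B j 1),
    fun v => dirDeriv_comm (matUnit A i v) (matUnit B j Complex.I)]
  simp only [Algebra.smul_def]
  ring

/-- The total derivative in terms of the Wirtinger derivatives:
`df(v) = ∑ v^A_i ∂f/∂z^A_i + conj(v^A_i) ∂f/∂z̄^A_i`. -/
theorem dirDeriv_eq_sum_wirtinger (v : Mat p q) (f : SmoothFun p q) :
    dirDeriv v f = ∑ A, ∑ i, (v A i • dz A i f + (starRingEnd ℂ (v A i)) • dzbar A i f) := by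
  have hv : v = ∑ A, ∑ i, ((v A i).re • matUnit A i 1 + (v A i).im • matUnit A i Complex.I) := by
    ext B j
    simp only [matUnit, Finset.sum_apply, Pi.add_apply, Pi.smul_apply, Matrix.of_symm_apply,
      Matrix.single_apply]
    rw [Finset.sum_eq_single B, Finset.sum_eq_single j]
    · simp
    · intro b _ hb; simp [hb]
    · simp
    · intro b _ hb; simp [hb]
    · simp
  ext z
  conv_lhs => rw [dirDeriv_apply, hv]
  simp only [map_sum, map_add, map_smul, ← dirDeriv_apply]
  simp only [AddSubmonoidClass.coe_finsetSum, Finset.sum_apply]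
  refine Finset.sum_congr rfl fun A _ => Finset.sum_congr rfl fun i _ => ?_
  simp only [dz_apply, dzbar_apply]
  simp only [Subalgebra.coe_add, Subalgebra.coe_smul, Subalgebra.coe_sub, Pi.add_apply,
    Pi.smul_apply, Pi.sub_apply, smul_eq_mul, Complex.real_smul]
  conv_rhs => rw [← Complex.re_add_im (v A i)]
  simp only [map_add, map_mul, Complex.conj_ofReal, Complex.conj_I]
  linear_combination ((((v A i).im : ℂ) * (dirDeriv (matUnit A i Complex.I) f).1 z)) *
    Complex.I_mul_I

/-- The coordinate function `z^A_i`. -/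
def zFun (A : Fin (p + q)) (i : Fin p) : SmoothFun p q :=
  ⟨fun z => z.1 A i, (contDiffOn_zeroExt_iff (g := fun z => z A i) fun _ => rfl).mpr
    (contDiff_apply_apply ℝ ℂ A i).contDiffOn⟩

/-- The coordinate function `z̄^A_i`. -/
def zbarFun (A : Fin (p + q)) (i : Fin p) : SmoothFun p q :=
  ⟨fun z => starRingEnd ℂ (z.1 A i),
    (contDiffOn_zeroExt_iff (g := fun z => starRingEnd ℂ (z A i)) fun _ => rfl).mpr
      (Complex.conjCLE.contDiff.comp (contDiff_apply_apply ℝ ℂ A i)).contDiffOn⟩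

theorem dirDeriv_zFun (v : Mat p q) (A : Fin (p + q)) (i : Fin p) :
    dirDeriv v (zFun A i) = algebraMap ℂ _ (v A i) := by
  ext z
  let l : Mat p q →L[ℝ] ℂ := (ContinuousLinearMap.proj (R := ℝ) (φ := fun _ : Fin p => ℂ) i).comp
    (ContinuousLinearMap.proj (R := ℝ) (φ := fun _ : Fin (p + q) => Fin p → ℂ) A)
  rw [dirDeriv_eq_of_eq v (zFun A i) (g := l) (fun _ => rfl), l.fderiv]
  rfl

theorem dirDeriv_zbarFun (v : Mat p q) (A : Fin (p + q)) (i : Fin p) :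
    dirDeriv v (zbarFun A i) = algebraMap ℂ _ (starRingEnd ℂ (v A i)) := by
  ext z
  let l : Mat p q →L[ℝ] ℂ := Complex.conjCLE.toContinuousLinearMap.comp
    ((ContinuousLinearMap.proj (R := ℝ) (φ := fun _ : Fin p => ℂ) i).comp
    (ContinuousLinearMap.proj (R := ℝ) (φ := fun _ : Fin (p + q) => Fin p → ℂ) A))
  rw [dirDeriv_eq_of_eq v (zbarFun A i) (g := l) (fun _ => rfl), l.fderiv]
  rfl

theorem matUnit_apply (A B : Fin (p + q)) (i j : Fin p) (c : ℂ) :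
    (matUnit A i c : Mat p q) B j = if A = B ∧ i = j then c else 0 := by
  simp [matUnit, Matrix.single_apply]

theorem dz_zFun (A B : Fin (p + q)) (i j : Fin p) :
    dz A i (zFun B j : SmoothFun p q) = if A = B ∧ i = j then 1 else 0 := by
  simp only [dz_apply, dirDeriv_zFun, matUnit_apply]
  split_ifs
  · ext z
    simp
    norm_num
  · simp

theorem dz_zbarFun (A B : Fin (p + q)) (i j : Fin p) :
    dz A i (zbarFun B j : SmoothFun p q) = 0 := by
  simp only [dz_apply, dirDeriv_zbarFun, matUnit_apply]
  split_ifs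
  · ext z
    simp
  · simp

theorem dzbar_zFun (A B : Fin (p + q)) (i j : Fin p) :
    dzbar A i (zFun B j : SmoothFun p q) = 0 := by
  simp only [dzbar_apply, dirDeriv_zFun, matUnit_apply]
  split_ifs
  · ext z
    simp
  · simp

theorem dzbar_zbarFun (A B : Fin (p + q)) (i j : Fin p) :
    dzbar A i (zbarFun B j : SmoothFun p q) = if A = B ∧ i = j then 1 else 0 := by
  simp only [dzbar_apply, dirDeriv_zbarFun, matUnit_apply]
  split_ifs
  · ext z
    simp
    norm_num
  · simp

theorem xFun_eq_sum (i j : Fin p) : xFun p q i j = ∑ A, zbarFun A i * zFun A j := by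
  ext z
  simp [xFun, Matrix.mul_apply, zbarFun, zFun]

theorem dz_xFun (A : Fin (p + q)) (k i j : Fin p) :
    dz A k (xFun p q i j) = if k = j then zbarFun A i else 0 := by
  simp only [xFun_eq_sum, map_sum, dz_mul, dz_zbarFun, dz_zFun, zero_mul, zero_add]
  rw [Finset.sum_eq_single A]
  · split_ifs <;> simp_all
  · intro b _ hb; simp [hb.symm]
  · simp

theorem dzbar_xFun (A : Fin (p + q)) (k i j : Fin p) :
    dzbar A k (xFun p q i j) = if k = i then zFun A j else 0 := by
  simp only [xFun_eq_sum, map_sum, dzbar_mul, dzbar_zbarFun, dzbar_zFun, mul_zero, add_zero]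
  rw [Finset.sum_eq_single A]
  · split_ifs <;> simp_all
  · intro b _ hb; simp [hb.symm]
  · simp

theorem dirDeriv_algebraMap (v : Mat p q) (c : ℂ) :
    dirDeriv v (algebraMap ℂ (SmoothFun p q) c) = 0 := by
  ext z
  rw [dirDeriv_eq_of_eq v _ (g := fun _ => c) (fun _ => rfl)]
  simp

theorem dz_algebraMap (A : Fin (p + q)) (i : Fin p) (c : ℂ) :
    dz A i (algebraMap ℂ (SmoothFun p q) c) = 0 := by
  simp [dz, dirDeriv_algebraMap]

theorem dzbar_algebraMap (A : Fin (p + q)) (i : Fin p) (c : ℂ) :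
    dzbar A i (algebraMap ℂ (SmoothFun p q) c) = 0 := by
  simp [dzbar, dirDeriv_algebraMap]

theorem xSub_apply (μ : ℝ) (i j : Fin p) :
    xSub p q μ i j = xFun p q i j - algebraMap ℂ _ (if i = j then (μ : ℂ) else 0) := by
  by_cases h : i = j <;> simp [xSub, h]

theorem dz_xSub (μ : ℝ) (A : Fin (p + q)) (k i j : Fin p) :
    dz A k (xSub p q μ i j) = if k = j then zbarFun A i else 0 := by
  rw [xSub_apply, map_sub, dz_algebraMap, dz_xFun, sub_zero]

theorem dzbar_xSub (μ : ℝ) (A : Fin (p + q)) (k i j : Fin p) :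
    dzbar A k (xSub p q μ i j) = if k = i then zFun A j else 0 := by
  rw [xSub_apply, map_sub, dzbar_algebraMap, dzbar_xFun, sub_zero]

end Calculus

/-! ### Associativity of the Wick product -/

section Wick

variable {p q : ℕ}

theorem wickTerm_zero (f g : SmoothFun p q) : wickTerm 0 f g = f * g := rfl

theorem wickTerm_succ (r : ℕ) (f g : SmoothFun p q) :
    wickTerm (r + 1) f g = ∑ a : Fin (p + q) × Fin p,
      wickTerm r (dz a.1 a.2 f) (dzbar a.1 a.2 g) := by
  simp [wickTerm, LinearMap.sum_apply, Fintype.sum_prod_type]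

theorem dz_wickTerm (r : ℕ) (A : Fin (p + q)) (i : Fin p) (f g : SmoothFun p q) :
    dz A i (wickTerm r f g) = wickTerm r (dz A i f) g + wickTerm r f (dz A i g) := by
  induction r generalizing f g with
  | zero => exact dz_mul A i f g
  | succ r ih =>
    simp only [wickTerm_succ, map_sum, ih, Finset.sum_add_distrib, dz_dz_comm A, dz_dzbar_comm A]

theorem dzbar_wickTerm (r : ℕ) (A : Fin (p + q)) (i : Fin p) (f g : SmoothFun p q) :
    dzbar A i (wickTerm r f g) = wickTerm r (dzbar A i f) g + wickTerm r f (dzbar A i g) := by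
  induction r generalizing f g with
  | zero => exact dzbar_mul A i f g
  | succ r ih =>
    simp only [wickTerm_succ, map_sum, ih, Finset.sum_add_distrib, ← dz_dzbar_comm,
      dzbar_dzbar_comm A]

variable (p q) in
/-- Ternary operations on smooth functions. -/
abbrev Ternary : Type := SmoothFun p q → SmoothFun p q → SmoothFun p q → SmoothFun p q

variable (p q) in
/-- Precomposition of a ternary operation with `∑ ∂/∂z ⊗ ∂/∂z̄ ⊗ 1`. -/
def contract12 : Module.End ℂ (Ternary p q) where
  toFun t f g h := ∑ a : Fin (p + q) × Fin p, t (dz a.1 a.2 f) (dzbar a.1 a.2 g) h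
  map_add' t t' := by ext1 f; ext1 g; ext1 h; simp [Finset.sum_add_distrib]
  map_smul' c t := by ext1 f; ext1 g; ext1 h; simp [Finset.smul_sum]

variable (p q) in
/-- Precomposition of a ternary operation with `∑ ∂/∂z ⊗ 1 ⊗ ∂/∂z̄`. -/
def contract13 : Module.End ℂ (Ternary p q) where
  toFun t f g h := ∑ a : Fin (p + q) × Fin p, t (dz a.1 a.2 f) g (dzbar a.1 a.2 h)
  map_add' t t' := by ext1 f; ext1 g; ext1 h; simp [Finset.sum_add_distrib]
  map_smul' c t := by ext1 f; ext1 g; ext1 h; simp [Finset.smul_sum]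

variable (p q) in
/-- Precomposition of a ternary operation with `∑ 1 ⊗ ∂/∂z ⊗ ∂/∂z̄`. -/
def contract23 : Module.End ℂ (Ternary p q) where
  toFun t f g h := ∑ a : Fin (p + q) × Fin p, t f (dz a.1 a.2 g) (dzbar a.1 a.2 h)
  map_add' t t' := by ext1 f; ext1 g; ext1 h; simp [Finset.sum_add_distrib]
  map_smul' c t := by ext1 f; ext1 g; ext1 h; simp [Finset.smul_sum]

theorem contract12_apply (t : Ternary p q) (f g h : SmoothFun p q) :
    contract12 p q t f g h =
      ∑ a : Fin (p + q) × Fin p, t (dz a.1 a.2 f) (dzbar a.1 a.2 g) h := rfl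

theorem contract13_apply (t : Ternary p q) (f g h : SmoothFun p q) :
    contract13 p q t f g h =
      ∑ a : Fin (p + q) × Fin p, t (dz a.1 a.2 f) g (dzbar a.1 a.2 h) := rfl

theorem contract23_apply (t : Ternary p q) (f g h : SmoothFun p q) :
    contract23 p q t f g h =
      ∑ a : Fin (p + q) × Fin p, t f (dz a.1 a.2 g) (dzbar a.1 a.2 h) := rfl

theorem commute_contract12_contract13 : Commute (contract12 p q) (contract13 p q) := by
  refine LinearMap.ext fun t => ?_
  ext1 f; ext1 g; ext1 h
  simp only [Module.End.mul_apply, contract12_apply, contract13_apply]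
  rw [Finset.sum_comm]
  simp only [fun a b : Fin (p + q) × Fin p => dz_dz_comm a.1 b.1 a.2 b.2 f]

theorem commute_contract12_contract23 : Commute (contract12 p q) (contract23 p q) := by
  refine LinearMap.ext fun t => ?_
  ext1 f; ext1 g; ext1 h
  simp only [Module.End.mul_apply, contract12_apply, contract23_apply]
  rw [Finset.sum_comm]
  simp only [fun a b : Fin (p + q) × Fin p => dz_dzbar_comm a.1 b.1 a.2 b.2 g]

theorem commute_contract13_contract23 : Commute (contract13 p q) (contract23 p q) := by
  refine LinearMap.ext fun t => ?_
  ext1 f; ext1 g; ext1 h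
  simp only [Module.End.mul_apply, contract13_apply, contract23_apply]
  rw [Finset.sum_comm]
  simp only [fun a b : Fin (p + q) × Fin p => dzbar_dzbar_comm a.1 b.1 a.2 b.2 h]

/-- The left-bracketed iterated term arises from the triple product because `∂/∂z` acts on the
inner term by the Leibniz rule. -/
theorem contract_pow_left (r s : ℕ) :
    ((contract12 p q) ^ s * (contract13 p q + contract23 p q) ^ r) (fun f g h => f * g * h) =
      fun f g h => wickTerm r (wickTerm s f g) h := by
  rw [((commute_contract12_contract13.add_right commute_contract12_contract23).pow_pow s r).eq]
  induction r with
  | zero =>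
    rw [pow_zero, one_mul]
    induction s with
    | zero => rfl
    | succ s ih =>
      rw [pow_succ', Module.End.mul_apply, ih]
      ext1 f; ext1 g; ext1 h
      simp only [contract12_apply, wickTerm_succ, wickTerm_zero, Finset.sum_mul]
  | succ r ih =>
    rw [pow_succ', mul_assoc, Module.End.mul_apply, ih]
    ext1 f; ext1 g; ext1 h
    simp only [LinearMap.add_apply, Pi.add_apply, contract13_apply, contract23_apply,
      wickTerm_succ r, dz_wickTerm, map_add, LinearMap.add_apply, Finset.sum_add_distrib]

/-- The right-bracketed iterated term arises from the triple product because `∂/∂z̄` acts on the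
inner term by the Leibniz rule. -/
theorem contract_pow_right (r s : ℕ) :
    ((contract12 p q + contract13 p q) ^ r * (contract23 p q) ^ s) (fun f g h => f * g * h) =
      fun f g h => wickTerm r f (wickTerm s g h) := by
  induction r with
  | zero =>
    rw [pow_zero, one_mul]
    induction s with
    | zero =>
      ext1 f; ext1 g; ext1 h
      exact mul_assoc f g h
    | succ s ih =>
      rw [pow_succ', Module.End.mul_apply, ih]
      ext1 f; ext1 g; ext1 h
      simp only [contract23_apply, wickTerm_succ, wickTerm_zero, Finset.mul_sum]
  | succ r ih =>
    rw [pow_succ', mul_assoc, Module.End.mul_apply, ih]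
    ext1 f; ext1 g; ext1 h
    simp only [LinearMap.add_apply, Pi.add_apply, contract13_apply, contract12_apply,
      wickTerm_succ r, dzbar_wickTerm, map_add, Finset.sum_add_distrib]

/-- The binomial theorem for divided powers. -/
theorem sum_inv_factorial_smul_pow {R : Type*} [Semiring R] [Algebra ℂ R] {x y : R}
    (h : Commute x y) (n : ℕ) :
    ∑ m ∈ antidiagonal n, ((m.1.factorial : ℂ)⁻¹ * (m.2.factorial : ℂ)⁻¹) • (x ^ m.1 * y ^ m.2) =
      (n.factorial : ℂ)⁻¹ • (x + y) ^ n := by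
  rw [h.add_pow', Finset.smul_sum]
  refine Finset.sum_congr rfl fun m hm => ?_
  obtain rfl := Finset.HasAntidiagonal.mem_antidiagonal.mp hm
  rw [← Nat.cast_smul_eq_nsmul ℂ, smul_smul]
  congr 1
  rw [Nat.cast_add_choose]
  have := Nat.cast_ne_zero (R := ℂ).mpr (Nat.factorial_ne_zero (m.1 + m.2))
  field_simp

/-- Both sides are the divided power of order `n` of the sum of the three contractions, applied to
the triple product. -/
theorem sum_wickTerm_assoc (n : ℕ) (f g h : SmoothFun p q) :
    ∑ m ∈ antidiagonal n, ((m.1.factorial : ℂ)⁻¹ * (m.2.factorial : ℂ)⁻¹) •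
        wickTerm m.2 (wickTerm m.1 f g) h =
      ∑ m ∈ antidiagonal n, ((m.1.factorial : ℂ)⁻¹ * (m.2.factorial : ℂ)⁻¹) •
        wickTerm m.1 f (wickTerm m.2 g h) := by
  have h1 := sum_inv_factorial_smul_pow ((commute_contract12_contract13
    (p := p) (q := q)).add_right (commute_contract12_contract23 (p := p) (q := q))) n
  have h2 := sum_inv_factorial_smul_pow ((commute_contract12_contract23
    (p := p) (q := q)).add_left (commute_contract13_contract23 (p := p) (q := q))) n
  rw [add_assoc, ← h1] at h2
  have h3 := congrArg (fun P : Module.End ℂ (Ternary p q) =>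
    P (fun f g h => f * g * h) f g h) h2
  simp only [LinearMap.sum_apply, LinearMap.smul_apply, contract_pow_left, contract_pow_right,
    Finset.sum_apply, Pi.smul_apply] at h3
  exact h3.symm

theorem coeff_wick (F G : Series p q) (n : ℕ) :
    PowerSeries.coeff n (wick F G) = ∑ x ∈ antidiagonal n, ∑ y ∈ antidiagonal x.2,
      ((y.1.factorial : ℂ)⁻¹) •
        wickTerm y.1 (PowerSeries.coeff x.1 F) (PowerSeries.coeff y.2 G) := by
  rw [show wick F G = wickSeries F G from rfl, wickSeries, PowerSeries.coeff_mk]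

theorem coeff_wick_C (F : Series p q) (g : SmoothFun p q) (n : ℕ) :
    PowerSeries.coeff n (wick F (PowerSeries.C g)) = ∑ x ∈ antidiagonal n,
      ((x.2.factorial : ℂ)⁻¹) • wickTerm x.2 (PowerSeries.coeff x.1 F) g := by
  rw [coeff_wick]
  refine Finset.sum_congr rfl fun x _ => ?_
  rw [Finset.sum_eq_single (x.2, 0)]
  · simp
  · rintro ⟨a, b⟩ hab hne
    have : b ≠ 0 := by
      rintro rfl
      simp at hab
      simp [hab] at hne
    simp [PowerSeries.coeff_C, this]
  · simp

theorem coeff_C_wick (f : SmoothFun p q) (G : Series p q) (n : ℕ) :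
    PowerSeries.coeff n (wick (PowerSeries.C f) G) = ∑ y ∈ antidiagonal n,
      ((y.1.factorial : ℂ)⁻¹) • wickTerm y.1 f (PowerSeries.coeff y.2 G) := by
  rw [coeff_wick, Finset.sum_eq_single (0, n)]
  · simp
  · rintro ⟨a, b⟩ hab hne
    have : a ≠ 0 := by
      rintro rfl
      simp at hab
      simp [hab] at hne
    simp [PowerSeries.coeff_C, this]
  · simp

theorem coeff_C_wick_C (f g : SmoothFun p q) (n : ℕ) :
    PowerSeries.coeff n (wick (PowerSeries.C f) (PowerSeries.C g)) =
      ((n.factorial : ℂ)⁻¹) • wickTerm n f g := by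
  rw [coeff_wick_C, Finset.sum_eq_single (0, n)]
  · simp
  · rintro ⟨a, b⟩ hab hne
    have : a ≠ 0 := by
      rintro rfl
      simp at hab
      simp [hab] at hne
    simp [PowerSeries.coeff_C, this]
  · simp

theorem X_smul_series (F : Series p q) : (PowerSeries.X : ℂ⟦X⟧) • F = PowerSeries.X * F := by
  rw [Algebra.smul_def, PowerSeries.algebraMap_apply'', PowerSeries.map_X]

theorem series_eq_C_add_X_smul (F : Series p q) :
    F = PowerSeries.C (PowerSeries.coeff 0 F) +
      (PowerSeries.X : ℂ⟦X⟧) • (PowerSeries.mk fun n => PowerSeries.coeff (n + 1) F) := by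
  rw [X_smul_series, add_comm]
  simpa using PowerSeries.eq_X_mul_shift_add_const F

theorem linearMap_apply_series (φ : Series p q →ₗ[ℂ⟦X⟧] Series p q) (F : Series p q) :
    φ F = φ (PowerSeries.C (PowerSeries.coeff 0 F)) +
      PowerSeries.X * φ (PowerSeries.mk fun n => PowerSeries.coeff (n + 1) F) := by
  conv_lhs => rw [series_eq_C_add_X_smul F, φ.map_add, φ.map_smul, X_smul_series]

/-- A `ℂ⟦λ⟧`-linear map of formal power series is determined by its values at constants. -/
theorem linearMap_ext_C {φ ψ : Series p q →ₗ[ℂ⟦X⟧] Series p q}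
    (h : ∀ f, φ (PowerSeries.C f) = ψ (PowerSeries.C f)) : φ = ψ := by
  refine LinearMap.ext fun F => PowerSeries.ext fun n => ?_
  induction n generalizing F with
  | zero =>
    rw [linearMap_apply_series φ, linearMap_apply_series ψ, h]
    simp
  | succ n ih =>
    rw [linearMap_apply_series φ, linearMap_apply_series ψ, h]
    simp only [map_add, PowerSeries.coeff_succ_X_mul, ih]

/-- Associativity of a `ℂ⟦λ⟧`-bilinear product may be checked on constants. -/
theorem bilinear_assoc_of_C {B : Series p q →ₗ[ℂ⟦X⟧] Series p q →ₗ[ℂ⟦X⟧] Series p q}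
    (h1 : ∀ f g h, B (B (PowerSeries.C f) (PowerSeries.C g)) (PowerSeries.C h) =
      B (PowerSeries.C f) (B (PowerSeries.C g) (PowerSeries.C h))) (F G H : Series p q) :
    B (B F G) H = B F (B G H) := by
  have h2 : ∀ (f g : SmoothFun p q) (H : Series p q),
      B (B (PowerSeries.C f) (PowerSeries.C g)) H =
        B (PowerSeries.C f) (B (PowerSeries.C g) H) := fun f g H =>
    LinearMap.congr_fun (linearMap_ext_C (φ := B (B (PowerSeries.C f) (PowerSeries.C g)))
      (ψ := (B (PowerSeries.C f)).comp (B (PowerSeries.C g))) (h1 f g)) H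
  have h3 : ∀ (f : SmoothFun p q) (G H : Series p q),
      B (B (PowerSeries.C f) G) H = B (PowerSeries.C f) (B G H) := fun f G H =>
    LinearMap.congr_fun (linearMap_ext_C (φ := (B.flip H).comp (B (PowerSeries.C f)))
      (ψ := (B (PowerSeries.C f)).comp (B.flip H)) fun g => h2 f g H) G
  exact LinearMap.congr_fun (linearMap_ext_C (φ := (B.flip H).comp (B.flip G))
      (ψ := B.flip (B G H)) fun f => h3 f G H) F

theorem wick_assoc (F G H : Series p q) : wick (wick F G) H = wick F (wick G H) := by
  refine bilinear_assoc_of_C (fun f g h => ?_) F G H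
  ext1 n
  rw [coeff_wick_C, coeff_C_wick]
  simpa only [coeff_C_wick_C, map_smul, LinearMap.smul_apply, smul_smul,
    mul_comm] using sum_wickTerm_assoc n f g h

/-! ### Wick products with the components of the moment map -/

/-- The `(1,0)` part `∑_A z^A_i ∂/∂z^A_j` of the infinitesimal right action. -/
def euler (i j : Fin p) (f : SmoothFun p q) : SmoothFun p q := ∑ A, zFun A i * dz A j f

/-- The `(0,1)` part `∑_A z̄^A_i ∂/∂z̄^A_j` of the infinitesimal right action. -/
def eulerBar (i j : Fin p) (f : SmoothFun p q) : SmoothFun p q := ∑ A, zbarFun A i * dzbar A j f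

theorem wickTerm_one_xSub (μ : ℝ) (f : SmoothFun p q) (i j : Fin p) :
    wickTerm 1 f (xSub p q μ j i) = euler i j f := by
  simp [wickTerm_succ, wickTerm_zero, dzbar_xSub, Fintype.sum_prod_type, euler, mul_comm]

theorem wickTerm_xSub_one (μ : ℝ) (f : SmoothFun p q) (i j : Fin p) :
    wickTerm 1 (xSub p q μ j i) f = eulerBar j i f := by
  simp [wickTerm_succ, wickTerm_zero, dz_xSub, Fintype.sum_prod_type, eulerBar]

theorem wickTerm_add_two_xSub (μ : ℝ) (r : ℕ) (f : SmoothFun p q) (i j : Fin p) :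
    wickTerm (r + 2) f (xSub p q μ j i) = 0 := by
  have : ∀ (A B : Fin (p + q)) (k l : Fin p), dzbar A k (dzbar B l (xSub p q μ j i)) = 0 :=
    fun A B k l => by
      rw [dzbar_xSub]
      split_ifs <;> simp [dzbar_zFun]
  simp [wickTerm_succ, this]

theorem wickTerm_add_two_xSub' (μ : ℝ) (r : ℕ) (f : SmoothFun p q) (i j : Fin p) :
    wickTerm (r + 2) (xSub p q μ j i) f = 0 := by
  have : ∀ (A B : Fin (p + q)) (k l : Fin p), dz A k (dz B l (xSub p q μ j i)) = 0 :=
    fun A B k l => by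
      rw [dz_xSub]
      split_ifs <;> simp [dz_zbarFun]
  simp [wickTerm_succ, this]

theorem coeff_zero_wick_xSub (μ : ℝ) (F : Series p q) (i j : Fin p) :
    PowerSeries.coeff 0 (wick F (PowerSeries.C (xSub p q μ j i))) =
      PowerSeries.coeff 0 F * xSub p q μ j i := by
  simp [coeff_wick_C, wickTerm_zero]

theorem coeff_succ_wick_xSub (μ : ℝ) (F : Series p q) (i j : Fin p) (n : ℕ) :
    PowerSeries.coeff (n + 1) (wick F (PowerSeries.C (xSub p q μ j i))) =
      PowerSeries.coeff (n + 1) F * xSub p q μ j i + euler i j (PowerSeries.coeff n F) := by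
  rw [coeff_wick_C, Finset.Nat.sum_antidiagonal_succ']
  congr 1
  · simp [wickTerm_zero]
  rw [← Finset.Nat.sum_antidiagonal_swap]
  cases n with
  | zero => simp [wickTerm_one_xSub]
  | succ n =>
    rw [Finset.Nat.sum_antidiagonal_succ]
    simp [wickTerm_one_xSub, wickTerm_add_two_xSub]

/-- The components of `x - μ` are star-central for those functions on which the two halves of the
infinitesimal right action agree. -/
theorem wick_xSub_comm (μ : ℝ) (F : Series p q) (i j : Fin p)
    (hF : ∀ n, euler i j (PowerSeries.coeff n F) = eulerBar j i (PowerSeries.coeff n F)) :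
    wick (PowerSeries.C (xSub p q μ j i)) F = wick F (PowerSeries.C (xSub p q μ j i)) := by
  have h : ∀ r n, wickTerm r (PowerSeries.coeff n F) (xSub p q μ j i) =
      wickTerm r (xSub p q μ j i) (PowerSeries.coeff n F) := fun r n => by
    match r with
    | 0 => exact mul_comm _ _
    | 1 => rw [wickTerm_one_xSub, wickTerm_xSub_one, hF]
    | r + 2 => rw [wickTerm_add_two_xSub, wickTerm_add_two_xSub']
  ext1 n
  rw [coeff_wick_C, coeff_C_wick, ← Finset.Nat.sum_antidiagonal_swap]
  simp [h]

theorem coeff_zero_pairing (μ : ℝ) (G : Matrix (Fin p) (Fin p) (Series p q)) :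
    PowerSeries.coeff 0 (pairing p q μ G) =
      ∑ i, ∑ j, PowerSeries.coeff 0 (G i j) * xSub p q μ j i := by
  simp only [pairing, LinearMap.coe_mk, AddHom.coe_mk, map_sum, coeff_zero_wick_xSub]

theorem coeff_succ_pairing (μ : ℝ) (G : Matrix (Fin p) (Fin p) (Series p q)) (n : ℕ) :
    PowerSeries.coeff (n + 1) (pairing p q μ G) =
      ∑ i, ∑ j, (PowerSeries.coeff (n + 1) (G i j) * xSub p q μ j i +
        euler i j (PowerSeries.coeff n (G i j))) := by
  simp only [pairing, LinearMap.coe_mk, AddHom.coe_mk, map_sum, coeff_succ_wick_xSub]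

end Wick

/-! ### Right translations and unitary invariance -/

section Translation

variable {p q : ℕ}

/-- Right multiplication of rectangular matrices by a square matrix. -/
def rightMul (M : Matrix (Fin p) (Fin p) ℂ) : Mat p q →L[ℝ] Mat p q :=
  LinearMap.toContinuousLinearMap
    { toFun := fun z => Matrix.of.symm (Matrix.of z * M)
      map_add' := fun z w => by ext; simp [Matrix.mul_apply, add_mul, Finset.sum_add_distrib]
      map_smul' := fun c z => by ext; simp [Matrix.mul_apply, Finset.mul_sum, mul_assoc] }

theorem rightMul_apply (M : Matrix (Fin p) (Fin p) ℂ) (z : Mat p q) (A : Fin (p + q))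
    (j : Fin p) : rightMul M z A j = ∑ k, z A k * M k j := rfl

/-- The pullback of smooth functions along the right translation by `g`. -/
def pull (g : GL (Fin p) ℂ) : SmoothFun p q →ₐ[ℂ] SmoothFun p q where
  toFun f := ⟨fun z => f.1 (act z g), by
    refine (contDiffOn_zeroExt_iff (g := fun z => zeroExt f.1 (rightMul g.1 z)) fun z =>
      (zeroExt_apply f.1 (act z g)).symm).mpr ?_
    exact ContDiffOn.comp f.2 (rightMul g.1).contDiff.contDiffOn fun z hz => (act ⟨z, hz⟩ g).2⟩
  map_one' := rfl
  map_mul' _ _ := rfl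
  map_zero' := rfl
  map_add' _ _ := rfl
  commutes' _ := rfl

theorem pull_apply (g : GL (Fin p) ℂ) (f : SmoothFun p q) (z : FullRank p q) :
    (pull g f).1 z = f.1 (act z g) := rfl

theorem dirDeriv_pull (g : GL (Fin p) ℂ) (v : Mat p q) (f : SmoothFun p q) :
    dirDeriv v (pull g f) = pull g (dirDeriv (rightMul g.1 v) f) := by
  ext z
  rw [dirDeriv_eq_of_eq v (pull g f) (g := zeroExt f.1 ∘ rightMul g.1)
    (fun z => (zeroExt_apply f.1 (act z g)).symm)]
  rw [((differentiableAt_zeroExt f (act z g)).hasFDerivAt.comp z.1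
    (rightMul g.1).hasFDerivAt).fderiv]
  rfl

theorem rightMul_matUnit (M : Matrix (Fin p) (Fin p) ℂ) (A B : Fin (p + q)) (i j : Fin p) (c : ℂ) :
    rightMul M (matUnit A i c) B j = if A = B then c * M i j else 0 := by
  rw [rightMul_apply, Finset.sum_eq_single i]
  · simp [matUnit_apply]
  · intro b _ hb; simp [matUnit_apply, hb.symm]
  · simp

theorem dirDeriv_rightMul_matUnit (M : Matrix (Fin p) (Fin p) ℂ) (A : Fin (p + q)) (i : Fin p)
    (c : ℂ) (f : SmoothFun p q) :
    dirDeriv (rightMul M (matUnit A i c)) f =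
      c • ∑ k, M i k • dz A k f +
        starRingEnd ℂ c • ∑ k, starRingEnd ℂ (M i k) • dzbar A k f := by
  rw [dirDeriv_eq_sum_wirtinger, Finset.sum_eq_single A]
  · simp [rightMul_matUnit, Finset.sum_add_distrib, Finset.smul_sum, mul_smul]
  · intro b _ hb; simp [rightMul_matUnit, hb.symm]
  · simp

theorem dz_pull (g : GL (Fin p) ℂ) (A : Fin (p + q)) (i : Fin p) (f : SmoothFun p q) :
    dz A i (pull g f) = ∑ k, g.1 i k • pull g (dz A k f) := by
  have h : ∑ k, g.1 i k • pull g (dz A k f) = pull g (∑ k, g.1 i k • dz A k f) := by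
    simp only [map_sum, map_smul]
  rw [h, dz_apply, dirDeriv_pull, dirDeriv_pull, dirDeriv_rightMul_matUnit,
    dirDeriv_rightMul_matUnit, ← map_smul, ← map_sub, ← map_smul]
  congr 1
  simp only [map_one, Complex.conj_I, one_smul, smul_add, smul_smul, Complex.I_mul_I, mul_neg]
  module

theorem dzbar_pull (g : GL (Fin p) ℂ) (A : Fin (p + q)) (i : Fin p) (f : SmoothFun p q) :
    dzbar A i (pull g f) = ∑ k, starRingEnd ℂ (g.1 i k) • pull g (dzbar A k f) := by
  have h : ∑ k, starRingEnd ℂ (g.1 i k) • pull g (dzbar A k f) =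
      pull g (∑ k, starRingEnd ℂ (g.1 i k) • dzbar A k f) := by
    simp only [map_sum, map_smul]
  rw [h, dzbar_apply, dirDeriv_pull, dirDeriv_pull, dirDeriv_rightMul_matUnit,
    dirDeriv_rightMul_matUnit, ← map_smul, ← map_add, ← map_smul]
  congr 1
  simp only [map_one, Complex.conj_I, one_smul, smul_add, smul_smul, Complex.I_mul_I, mul_neg]
  module

/-- The general linear element underlying a unitary matrix. -/
abbrev unitaryGL (U : Matrix.unitaryGroup (Fin p) ℂ) : GL (Fin p) ℂ := Unitary.toUnits U

theorem unitary_sum_mul_conj (U : Matrix.unitaryGroup (Fin p) ℂ) (k l : Fin p) :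
    ∑ i, U.1 i k * starRingEnd ℂ (U.1 i l) = if k = l then 1 else 0 := by
  have h := congrFun (congrFun (Matrix.mem_unitaryGroup_iff'.mp U.2) l) k
  simpa [Matrix.mul_apply, Matrix.one_apply, mul_comm, eq_comm] using h

/-- The Wick product is invariant under the unitary group because `∑ ∂/∂z ⊗ ∂/∂z̄` is. -/
theorem wickTerm_pull (U : Matrix.unitaryGroup (Fin p) ℂ) (r : ℕ) (f g : SmoothFun p q) :
    wickTerm r (pull (unitaryGL U) f) (pull (unitaryGL U) g) =
      pull (unitaryGL U) (wickTerm r f g) := by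
  induction r generalizing f g with
  | zero => rfl
  | succ r ih =>
    simp only [wickTerm_succ, Fintype.sum_prod_type, map_sum]
    refine Finset.sum_congr rfl fun A _ => ?_
    simp only [dz_pull, dzbar_pull, map_sum, LinearMap.sum_apply, map_smul, LinearMap.smul_apply,
      ih]
    calc _ = ∑ k, ∑ l, (∑ i, U.1 i k * starRingEnd ℂ (U.1 i l)) •
          pull (unitaryGL U) (wickTerm r (dz A k f) (dzbar A l g)) := by
          simp only [Finset.sum_smul]
          simp only [Finset.smul_sum, smul_smul]
          refine (Finset.sum_congr rfl fun i _ => Finset.sum_comm).trans ?_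
          rw [Finset.sum_comm]
          refine Finset.sum_congr rfl fun k _ => ?_
          rw [Finset.sum_comm]
          simp only [mul_comm]
          rfl
      _ = _ := by simp [unitary_sum_mul_conj]

/-- The pullback of formal power series along a right translation. -/
abbrev pullSeries (g : GL (Fin p) ℂ) : Series p q →+* Series p q :=
  PowerSeries.map (pull (q := q) g : SmoothFun p q →+* SmoothFun p q)

theorem coeff_pullSeries (g : GL (Fin p) ℂ) (F : Series p q) (n : ℕ) :
    PowerSeries.coeff n (pullSeries g F) = pull g (PowerSeries.coeff n F) :=
  PowerSeries.coeff_map _ _ _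

theorem wick_pullSeries (U : Matrix.unitaryGroup (Fin p) ℂ) (F G : Series p q) :
    wick (pullSeries (unitaryGL U) F) (pullSeries (unitaryGL U) G) =
      pullSeries (unitaryGL U) (wick F G) := by
  ext1 n
  simp only [coeff_pullSeries, coeff_wick, wickTerm_pull, map_sum, map_smul]

theorem mem_invariantFun_iff {f : SmoothFun p q} :
    f ∈ invariantFun p q ↔ ∀ U, pull (unitaryGL U) f = f :=
  ⟨fun h U => Subtype.ext (funext fun z => h U z), fun h U z =>
    congrFun (congrArg Subtype.val (h U)) z⟩

theorem mem_Inv_iff {F : Series p q} :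
    F ∈ Inv p q ↔ ∀ U, pullSeries (unitaryGL U) F = F := by
  constructor
  · intro h U
    ext1 n
    rw [coeff_pullSeries, mem_invariantFun_iff.mp (h n)]
  · intro h n
    refine mem_invariantFun_iff.mpr fun U => ?_
    rw [← coeff_pullSeries, h U]

theorem wick_mem_Inv {F G : Series p q} (hF : F ∈ Inv p q) (hG : G ∈ Inv p q) :
    wick F G ∈ Inv p q := by
  rw [mem_Inv_iff] at *
  intro U
  rw [← wick_pullSeries, hF, hG]

theorem coeff_C_smul (c : ℂ) (F : Series p q) (n : ℕ) :
    PowerSeries.coeff n ((PowerSeries.C c : ℂ⟦X⟧) • F) = c • PowerSeries.coeff n F := by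
  rw [coeff_smul_series, Finset.sum_eq_single (0, n)]
  · simp
  · rintro ⟨a, b⟩ hab hne
    have : a ≠ 0 := by
      rintro rfl
      simp at hab
      simp [hab] at hne
    simp [PowerSeries.coeff_C, this]
  · simp

/-- Equivariance expressed by the pullbacks of the entries, which is the form in which it is
compatible with the star product. -/
theorem mem_Equivariant_iff {G : Matrix (Fin p) (Fin p) (Series p q)} :
    G ∈ Equivariant p q ↔ ∀ U : Matrix.unitaryGroup (Fin p) ℂ, ∀ i j,
      pullSeries (unitaryGL U) (G i j) = ∑ k, ∑ l,
        (PowerSeries.C ((U⁻¹ : Matrix.unitaryGroup (Fin p) ℂ).1 i k * U.1 l j) : ℂ⟦X⟧) •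
          G k l := by
  have key : ∀ (n : ℕ) (U : Matrix.unitaryGroup (Fin p) ℂ) (z : FullRank p q) (i j : Fin p),
      ((U⁻¹ : Matrix.unitaryGroup (Fin p) ℂ).1 * coeffAt n z G * U.1) i j =
        (PowerSeries.coeff n (∑ k, ∑ l,
        (PowerSeries.C ((U⁻¹ : Matrix.unitaryGroup (Fin p) ℂ).1 i k * U.1 l j) : ℂ⟦X⟧) •
          G k l)).1 z := fun n U z i j => by
    simp only [map_sum, coeff_C_smul, AddSubmonoidClass.coe_finsetSum, Finset.sum_apply,
      Subalgebra.coe_smul, Pi.smul_apply, smul_eq_mul, Matrix.mul_apply, Finset.sum_mul, coeffAt,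
      Matrix.of_apply]
    rw [Finset.sum_comm]
    exact Finset.sum_congr rfl fun k _ => Finset.sum_congr rfl fun l _ => by ring
  constructor
  · intro h U i j
    ext n z
    rw [← key, ← h n U z]
    rfl
  · intro h n U z
    ext i j
    rw [key, ← h U i j]
    rfl

theorem wick_mem_Equivariant {F : Series p q} (hF : F ∈ Inv p q)
    {G : Matrix (Fin p) (Fin p) (Series p q)} (hG : G ∈ Equivariant p q) :
    (Matrix.of fun i j => wick F (G i j)) ∈ Equivariant p q := by
  rw [mem_Equivariant_iff] at *
  rw [mem_Inv_iff] at hF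
  intro U i j
  simp only [Matrix.of_apply, ← wick_pullSeries, hF, hG U, map_sum, map_smul]

theorem wick_mem_Equivariant' {F : Series p q} (hF : F ∈ Inv p q)
    {G : Matrix (Fin p) (Fin p) (Series p q)} (hG : G ∈ Equivariant p q) :
    (Matrix.of fun i j => wick (G i j) F) ∈ Equivariant p q := by
  rw [mem_Equivariant_iff] at *
  rw [mem_Inv_iff] at hF
  intro U i j
  simp only [Matrix.of_apply, ← wick_pullSeries, hF, hG U, map_sum, map_smul,
    LinearMap.sum_apply, LinearMap.smul_apply]

theorem xFun_act (g : GL (Fin p) ℂ) (z : FullRank p q) :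
    (Matrix.of (act z g).1)ᴴ * Matrix.of (act z g).1 =
      g.1ᴴ * ((Matrix.of z.1)ᴴ * Matrix.of z.1) * g.1 := by
  have : Matrix.of (act z g).1 = Matrix.of z.1 * g.1 := rfl
  rw [this, Matrix.conjTranspose_mul]
  simp only [Matrix.mul_assoc]

theorem xSub_val (μ : ℝ) (z : FullRank p q) :
    (Matrix.of fun i j => (xSub p q μ i j).1 z) =
      (Matrix.of z.1)ᴴ * Matrix.of z.1 - Matrix.scalar (Fin p) (μ : ℂ) := by
  ext i j
  rw [Matrix.of_apply, xSub_apply]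
  by_cases h : i = j <;> simp [xFun, h, Matrix.scalar_apply]

theorem pull_xSub (μ : ℝ) (U : Matrix.unitaryGroup (Fin p) ℂ) (i j : Fin p) :
    pull (unitaryGL U) (xSub p q μ i j) = ∑ k, ∑ l,
      ((U⁻¹ : Matrix.unitaryGroup (Fin p) ℂ).1 i k * U.1 l j) • xSub p q μ k l := by
  ext z
  have h := congrFun (congrFun (xSub_val μ (act z (unitaryGL U))) i) j
  have h2 : (unitaryGL U).1ᴴ = (U⁻¹ : Matrix.unitaryGroup (Fin p) ℂ).1 := rfl
  have h3 : (Matrix.scalar (Fin p) (μ : ℂ)) = (U⁻¹ : Matrix.unitaryGroup (Fin p) ℂ).1 *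
      (Matrix.scalar (Fin p) (μ : ℂ)) * U.1 := by
    rw [← (Matrix.scalar_commute (μ : ℂ) (fun _ => mul_comm _ _) _).eq, Matrix.mul_assoc]
    have : (U⁻¹ : Matrix.unitaryGroup (Fin p) ℂ).1 * U.1 = 1 := by
      rw [← Submonoid.coe_mul]; simp
    rw [this, Matrix.mul_one]
  rw [xFun_act, h2, h3] at h
  have h4 : (unitaryGL U).1 = U.1 := rfl
  rw [h4, ← Matrix.sub_mul, ← Matrix.mul_sub, ← xSub_val] at h
  rw [pull_apply]
  refine Eq.trans h ?_
  simp only [AddSubmonoidClass.coe_finsetSum, Finset.sum_apply,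
      Subalgebra.coe_smul, Pi.smul_apply, smul_eq_mul, Matrix.mul_apply, Finset.sum_mul,
      Matrix.of_apply]
  rw [Finset.sum_comm]
  exact Finset.sum_congr rfl fun k _ => Finset.sum_congr rfl fun l _ => by ring

theorem sum_rotate {ι M : Type*} [Fintype ι] [AddCommMonoid M] (f : ι → ι → ι → ι → ι → M) :
    ∑ i, ∑ k, ∑ l, ∑ k', ∑ l', f i k l k' l' = ∑ k, ∑ l, ∑ k', ∑ l', ∑ i, f i k l k' l' := by
  rw [Finset.sum_comm]
  refine Finset.sum_congr rfl fun k _ => ?_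
  rw [Finset.sum_comm]
  refine Finset.sum_congr rfl fun l _ => ?_
  rw [Finset.sum_comm]
  exact Finset.sum_congr rfl fun k' _ => Finset.sum_comm

/-- The trace pairing is invariant under conjugation. -/
theorem sum_conj_conj {R M : Type*} [CommRing R] [AddCommGroup M] [Module R M]
    {U V : Matrix (Fin p) (Fin p) R} (h : U * V = 1) (t : Fin p → Fin p → Fin p → Fin p → M) :
    ∑ i, ∑ j, ∑ k, ∑ l, ∑ k', ∑ l', (V i k * U l j * (V j k' * U l' i)) • t k l k' l' =
      ∑ k, ∑ l, t k l l k := by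
  have hs : ∀ a b, ∑ j, U a j * V j b = if a = b then 1 else 0 := fun a b => by
    rw [← Matrix.mul_apply, h, Matrix.one_apply]
  calc _ = ∑ k, ∑ l, ∑ k', ∑ l', ∑ i, ∑ j, (V i k * U l j * (V j k' * U l' i)) • t k l k' l' := by
        exact (Finset.sum_congr rfl fun i _ => sum_rotate _).trans (sum_rotate _)
    _ = ∑ k, ∑ l, ∑ k', ∑ l', ((∑ i, U l' i * V i k) * ∑ j, U l j * V j k') • t k l k' l' := by
        refine Finset.sum_congr rfl fun k _ => Finset.sum_congr rfl fun l _ =>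
          Finset.sum_congr rfl fun k' _ => Finset.sum_congr rfl fun l' _ => ?_
        rw [Finset.sum_mul_sum]
        simp only [Finset.sum_smul]
        exact Finset.sum_congr rfl fun k _ => Finset.sum_congr rfl fun l _ => by
          congr 1; ring
    _ = _ := by simp [hs]

theorem pairing_mem_Inv (μ : ℝ) {G : Matrix (Fin p) (Fin p) (Series p q)}
    (hG : G ∈ Equivariant p q) : pairing p q μ G ∈ Inv p q := by
  rw [mem_Inv_iff]
  intro U
  rw [mem_Equivariant_iff] at hG
  have hC : ∀ i j, pullSeries (unitaryGL U) (PowerSeries.C (xSub p q μ i j)) = ∑ k, ∑ l,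
      (PowerSeries.C ((U⁻¹ : Matrix.unitaryGroup (Fin p) ℂ).1 i k * U.1 l j) : ℂ⟦X⟧) •
        PowerSeries.C (xSub p q μ k l) := fun i j => by
    ext1 n
    simp only [coeff_pullSeries, map_sum, coeff_C_smul, PowerSeries.coeff_C]
    split_ifs
    · exact pull_xSub μ U i j
    · simp
  simp only [pairing, LinearMap.coe_mk, AddHom.coe_mk, map_sum, ← wick_pullSeries, hG U, hC,
    map_smul, LinearMap.sum_apply, LinearMap.smul_apply, Finset.smul_sum, smul_smul, map_mul]
  have hU : (U.1.map (PowerSeries.C (R := ℂ))) *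
      ((U⁻¹ : Matrix.unitaryGroup (Fin p) ℂ).1.map (PowerSeries.C (R := ℂ))) = 1 := by
    rw [← Matrix.map_mul, ← Submonoid.coe_mul]
    simp
  have h := sum_conj_conj hU fun k l k' l' => wick (G k l) (PowerSeries.C (xSub p q μ k' l'))
  rw [← h]
  refine Finset.sum_congr rfl fun i _ => Finset.sum_congr rfl fun j _ => ?_
  simp only [Matrix.map_apply]
  calc _ = ∑ k', ∑ k, ∑ l, ∑ l', (PowerSeries.C ((U⁻¹ : Matrix.unitaryGroup (Fin p) ℂ).1 i k) *
        PowerSeries.C (U.1 l j) * (PowerSeries.C ((U⁻¹ : Matrix.unitaryGroup (Fin p) ℂ).1 j k') *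
        PowerSeries.C (U.1 l' i)) : ℂ⟦X⟧) • wick (G k l) (PowerSeries.C (xSub p q μ k' l')) := by
        refine Finset.sum_congr rfl fun k' _ => ?_
        rw [Finset.sum_comm]
        refine Finset.sum_congr rfl fun k _ => ?_
        rw [Finset.sum_comm]
        refine Finset.sum_congr rfl fun l _ => Finset.sum_congr rfl fun l' _ => ?_
        congr 1
        ring
    _ = _ := by
        rw [Finset.sum_comm]
        refine Finset.sum_congr rfl fun k _ => ?_
        rw [Finset.sum_comm]

theorem starIdeal_le_Inv (μ : ℝ) : starIdeal p q μ ≤ Inv p q := by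
  rintro _ ⟨G, hG, rfl⟩
  exact pairing_mem_Inv μ hG

/-! ### The infinitesimal right action -/

/-- If `f` is constant along the curve `t ↦ z exp (t ξ)`, then its derivative in the direction `z ξ`
vanishes. -/
theorem dirDeriv_rightMul_eq_zero {f : SmoothFun p q} {ξ : Matrix (Fin p) (Fin p) ℂ}
    {z : FullRank p q}
    (h : ∀ t : ℝ, zeroExt f.1 (rightMul (NormedSpace.exp (t • ξ)) z.1) = f.1 z) :
    (dirDeriv (rightMul ξ z.1) f).1 z = 0 := by
  open scoped Matrix.Norms.L2Operator in
  let l : Matrix (Fin p) (Fin p) ℂ →L[ℝ] Mat p q := LinearMap.toContinuousLinearMap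
    { toFun := fun M => rightMul M z.1
      map_add' := fun M N => by
        ext
        simp [rightMul_apply, mul_add, Finset.sum_add_distrib]
      map_smul' := fun c M => by
        ext
        simp [rightMul_apply, Finset.mul_sum, mul_left_comm] }
  have h1 : HasDerivAt (fun t : ℝ => NormedSpace.exp (t • ξ)) ξ 0 := by
    simpa using hasDerivAt_exp_smul_const (𝕂 := ℝ) ξ (0 : ℝ)
  have h2 : HasDerivAt (fun t : ℝ => l (NormedSpace.exp (t • ξ))) (l ξ) 0 :=
    l.hasFDerivAt.comp_hasDerivAt 0 h1
  have h0 : l (NormedSpace.exp ((0 : ℝ) • ξ)) = z.1 := by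
    rw [zero_smul, NormedSpace.exp_zero]
    ext A j
    simp [l, rightMul_apply, Matrix.one_apply]
  have h3 : HasFDerivAt (zeroExt f.1) (fderiv ℝ (zeroExt f.1) z.1)
      (l (NormedSpace.exp ((0 : ℝ) • ξ))) := by
    rw [h0]
    exact (differentiableAt_zeroExt f z).hasFDerivAt
  have h4 := h3.comp_hasDerivAt (0 : ℝ) h2
  have h5 : zeroExt f.1 ∘ (fun t : ℝ => l (NormedSpace.exp (t • ξ))) = fun _ => f.1 z :=
    funext h
  rw [h5] at h4
  exact h4.unique (hasDerivAt_const _ _)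

theorem dirDeriv_rightMul_eq_zero_of_skew {f : SmoothFun p q} (hf : f ∈ invariantFun p q)
    {ξ : Matrix (Fin p) (Fin p) ℂ} (hξ : ξᴴ = -ξ) (z : FullRank p q) :
    (dirDeriv (rightMul ξ z.1) f).1 z = 0 := by
  refine dirDeriv_rightMul_eq_zero fun t => ?_
  open scoped Matrix.Norms.L2Operator in
  have ht : NormedSpace.exp (t • ξ) ∈ unitary (Matrix (Fin p) (Fin p) ℂ) := by
    let _ : NormedAlgebra ℚ (Matrix (Fin p) (Fin p) ℂ) := NormedAlgebra.restrictScalars ℚ ℝ _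
    refine NormedSpace.exp_mem_unitary_of_mem_skewAdjoint ?_
    rw [skewAdjoint.mem_iff, Matrix.star_eq_conjTranspose, Matrix.conjTranspose_smul, hξ,
      star_trivial, smul_neg]
  exact (zeroExt_apply f.1 (act z (unitaryGL ⟨_, ht⟩))).trans (hf ⟨_, ht⟩ z)

theorem dirDeriv_rightMul_eq_zero_of_homogeneous {f : SmoothFun p q}
    (hf : f ∈ homogeneousFun p q) (ξ : Matrix (Fin p) (Fin p) ℂ) (z : FullRank p q) :
    (dirDeriv (rightMul ξ z.1) f).1 z = 0 := by
  refine dirDeriv_rightMul_eq_zero fun t => ?_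
  have ht : IsUnit (NormedSpace.exp (t • ξ)) := Matrix.isUnit_exp _
  exact (zeroExt_apply f.1 (act z ht.unit)).trans (hf ht.unit z)

theorem euler_apply (i j : Fin p) (f : SmoothFun p q) (z : FullRank p q) :
    (euler i j f).1 z = ∑ A, z.1 A i * (dz A j f).1 z := by
  simp [euler, zFun]

theorem eulerBar_apply (i j : Fin p) (f : SmoothFun p q) (z : FullRank p q) :
    (eulerBar i j f).1 z = ∑ A, starRingEnd ℂ (z.1 A i) * (dzbar A j f).1 z := by
  simp [eulerBar, zbarFun]

theorem dirDeriv_rightMul (M : Matrix (Fin p) (Fin p) ℂ) (f : SmoothFun p q) (z : FullRank p q) :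
    (dirDeriv (rightMul M z.1) f).1 z = ∑ i, ∑ j, (M i j * (euler i j f).1 z +
      starRingEnd ℂ (M i j) * (eulerBar i j f).1 z) := by
  simp only [dirDeriv_eq_sum_wirtinger, rightMul_apply, AddSubmonoidClass.coe_finsetSum,
    Finset.sum_apply, Subalgebra.coe_add, Subalgebra.coe_smul, Pi.add_apply, Pi.smul_apply,
    smul_eq_mul, euler_apply, eulerBar_apply, map_sum, map_mul, Finset.sum_mul, Finset.mul_sum,
    ← Finset.sum_add_distrib]
  rw [Finset.sum_comm]
  simp only [Finset.sum_comm (s := (Finset.univ : Finset (Fin (p + q))))]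
  rw [Finset.sum_comm]
  refine Finset.sum_congr rfl fun k _ => Finset.sum_congr rfl fun l _ =>
    Finset.sum_congr rfl fun A _ => by ring

theorem sum_single_mul (a b : Fin p) (c : ℂ) (F : Fin p → Fin p → ℂ) :
    ∑ i, ∑ j, Matrix.single a b c i j * F i j = c * F a b := by
  rw [Finset.sum_eq_single a, Finset.sum_eq_single b]
  · simp
  · intro j _ hj; simp [hj.symm]
  · simp
  · intro j _ hj; simp [hj.symm]
  · simp

/-- On invariant functions the two halves of the infinitesimal right action agree, because
`gl(p, ℂ)` is the complexification of `u(p)`. -/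
theorem euler_eq_eulerBar {f : SmoothFun p q} (hf : f ∈ invariantFun p q) (i j : Fin p) :
    euler i j f = eulerBar j i f := by
  ext z
  have hn : ∀ a b : Fin p, Matrix.single a b (-Complex.I) = -Matrix.single a b Complex.I :=
    fun a b => by
      ext k l
      simp only [Matrix.neg_apply, Matrix.single_apply]
      split_ifs <;> simp
  have h1 := dirDeriv_rightMul_eq_zero_of_skew hf
    (ξ := Matrix.single i j 1 - Matrix.single j i 1) (by
      simp only [Matrix.conjTranspose_sub, Matrix.conjTranspose_single, star_one]
      abel) z
  have h2 := dirDeriv_rightMul_eq_zero_of_skew hf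
    (ξ := Matrix.single i j Complex.I + Matrix.single j i Complex.I) (by
      simp only [Matrix.conjTranspose_add, Matrix.conjTranspose_single, Complex.star_def,
        Complex.conj_I, hn]
      abel) z
  rw [dirDeriv_rightMul] at h1 h2
  have hc : ∀ (a b : Fin p) (c : ℂ) (k l : Fin p), starRingEnd ℂ (Matrix.single a b c k l) =
    Matrix.single a b (starRingEnd ℂ c) k l := fun a b c k l => by
      simp only [Matrix.single_apply]; split_ifs <;> simp
  simp only [Matrix.add_apply, Matrix.sub_apply, map_add, map_sub, hc, add_mul, sub_mul,
    Finset.sum_add_distrib, Finset.sum_sub_distrib, map_one, Complex.conj_I] at h1 h2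
  simp only [sum_single_mul] at h1 h2
  linear_combination (1 / 2 : ℂ) * h1 - Complex.I / 2 * h2 + (1 / 2 : ℂ) * ((euler i j f).1 z +
    (euler j i f).1 z - (eulerBar i j f).1 z - (eulerBar j i f).1 z) * Complex.I_mul_I

theorem euler_eq_zero {f : SmoothFun p q} (hf : f ∈ homogeneousFun p q) (i j : Fin p) :
    euler i j f = 0 := by
  ext z
  have h1 := dirDeriv_rightMul_eq_zero_of_homogeneous hf (Matrix.single i j 1) z
  have h2 := dirDeriv_rightMul_eq_zero_of_homogeneous hf (Matrix.single i j Complex.I) z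
  rw [dirDeriv_rightMul] at h1 h2
  have hc : ∀ (a b : Fin p) (c : ℂ) (k l : Fin p), starRingEnd ℂ (Matrix.single a b c k l) =
    Matrix.single a b (starRingEnd ℂ c) k l := fun a b c k l => by
      simp only [Matrix.single_apply]; split_ifs <;> simp
  simp only [hc, Finset.sum_add_distrib, map_one, Complex.conj_I] at h1 h2
  simp only [sum_single_mul] at h1 h2
  show (euler i j f).1 z = 0
  linear_combination (1 / 2 : ℂ) * h1 - Complex.I / 2 * h2 + (1 / 2 : ℂ) * ((euler i j f).1 z -
    (eulerBar i j f).1 z) * Complex.I_mul_I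

/-- The components of `x - μ` commute with all invariant series for the star product. -/
theorem wick_xSub_comm_of_mem_Inv (μ : ℝ) {F : Series p q} (hF : F ∈ Inv p q) (i j : Fin p) :
    wick (PowerSeries.C (xSub p q μ j i)) F = wick F (PowerSeries.C (xSub p q μ j i)) :=
  wick_xSub_comm μ F i j fun n => euler_eq_eulerBar (hF n) i j

/-! ### The two-sided ideal property -/

theorem wick_mem_starIdeal (μ : ℝ) {F K : Series p q} (hF : F ∈ Inv p q)
    (hK : K ∈ starIdeal p q μ) : wick F K ∈ starIdeal p q μ := by
  obtain ⟨G, hG, rfl⟩ := hK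
  refine ⟨_, wick_mem_Equivariant hF hG, ?_⟩
  simp only [pairing, LinearMap.coe_mk, AddHom.coe_mk, map_sum, Matrix.of_apply, wick_assoc]

/-- An invariant factor on the right moves past `x - μ` and joins the equivariant matrix. -/
theorem wick_mem_starIdeal' (μ : ℝ) {F K : Series p q} (hF : F ∈ Inv p q)
    (hK : K ∈ starIdeal p q μ) : wick K F ∈ starIdeal p q μ := by
  obtain ⟨G, hG, rfl⟩ := hK
  refine ⟨_, wick_mem_Equivariant' hF hG, ?_⟩
  simp only [pairing, LinearMap.coe_mk, AddHom.coe_mk, map_sum, LinearMap.sum_apply,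
    Matrix.of_apply, wick_assoc, wick_xSub_comm_of_mem_Inv μ hF]

end Translation

/-! ### The Weyl algebra acting on formal jets -/

section Jets

variable {ι : Type*}

/-- Formal power series in variables indexed by `ι`, recorded by their iterated partial derivatives
at the origin. -/
abbrev Jet (ι : Type*) : Type _ := Multiset ι → ℂ

/-- The partial derivative `∂/∂y_a`. -/
def jetDeriv (a : ι) : Jet ι →ₗ[ℂ] Jet ι where
  toFun g s := g (a ::ₘ s)
  map_add' _ _ := rfl
  map_smul' _ _ := rfl

theorem jetDeriv_apply (a : ι) (g : Jet ι) (s : Multiset ι) :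
    jetDeriv a g s = g (a ::ₘ s) := rfl

theorem jetDeriv_comm (a b : ι) (g : Jet ι) :
    jetDeriv a (jetDeriv b g) = jetDeriv b (jetDeriv a g) := by
  ext s
  simp only [jetDeriv_apply, Multiset.cons_swap]

variable [DecidableEq ι]

/-- Multiplication by the variable `y_a`. -/
def jetMul (a : ι) : Jet ι →ₗ[ℂ] Jet ι where
  toFun g s := (s.count a : ℂ) * g (s.erase a)
  map_add' _ _ := funext fun _ => mul_add _ _ _
  map_smul' _ _ := funext fun _ => mul_left_comm _ _ _

theorem jetMul_apply (a : ι) (g : Jet ι) (s : Multiset ι) :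
    jetMul a g s = (s.count a : ℂ) * g (s.erase a) := rfl

theorem count_mul_cons_erase (a : ι) (g : Jet ι) (s : Multiset ι) :
    (s.count a : ℂ) * g (a ::ₘ s.erase a) = s.count a * g s := by
  by_cases h : a ∈ s
  · rw [Multiset.cons_erase h]
  · rw [Multiset.count_eq_zero_of_notMem h]
    simp

theorem jetDeriv_jetMul (a b : ι) (g : Jet ι) :
    jetDeriv a (jetMul b g) = jetMul b (jetDeriv a g) + if a = b then g else 0 := by
  ext s
  rw [Pi.add_apply, jetDeriv_apply, jetMul_apply, jetMul_apply, jetDeriv_apply]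
  by_cases h : a = b
  · subst h
    rw [count_mul_cons_erase, Multiset.count_cons_self, Multiset.erase_cons_head, if_pos rfl]
    push_cast
    ring
  · rw [Multiset.count_cons_of_ne (Ne.symm h), Multiset.erase_cons_tail _ h, if_neg h]
    simp

theorem jetMul_comm (a b : ι) (g : Jet ι) : jetMul a (jetMul b g) = jetMul b (jetMul a g) := by
  ext s
  simp only [jetMul_apply]
  by_cases h : a = b
  · rw [h]
  · rw [Multiset.count_erase_of_ne (Ne.symm h), Multiset.count_erase_of_ne h, Multiset.erase_comm]
    ring

theorem sum_jetMul_jetDeriv [Fintype ι] (g : Jet ι) (s : Multiset ι) :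
    (∑ b, jetMul b (jetDeriv b g)) s = (Multiset.card s : ℂ) * g s := by
  rw [Finset.sum_apply]
  simp only [jetMul_apply, jetDeriv_apply, count_mul_cons_erase]
  rw [← Finset.sum_mul, ← Nat.cast_sum, Multiset.sum_count_eq_card fun a _ => Finset.mem_univ a]

/-- Exactness of the Koszul complex of the variables in degree one: every relation `∑ y_a G_a = 0`
is a consequence of the commutativity relations. The witness is the usual contracting homotopy,
built from the exterior derivative and a division by the degree. -/
theorem exists_antisymm_of_sum_jetMul_eq_zero [Fintype ι] {G : ι → Jet ι}
    (hG : ∑ a, jetMul a (G a) = 0) :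
    ∃ A : ι → ι → Jet ι, (∀ a b, A a b = -A b a) ∧ ∀ a, G a = ∑ b, jetMul b (A a b) := by
  refine ⟨fun a b s => (jetDeriv b (G a) s - jetDeriv a (G b) s) / (Multiset.card s + 2),
    fun a b => ?_, fun a => ?_⟩
  · ext s
    simp only [Pi.neg_apply]
    ring
  have hne : ∀ s : Multiset ι, (Multiset.card s : ℂ) + 1 ≠ 0 := fun s => by
    exact_mod_cast Nat.succ_ne_zero (Multiset.card s)
  have h1 : ∀ b (g : Jet ι) (s : Multiset ι),
      jetMul b (fun s => g s / (Multiset.card s + 2)) s =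
        jetMul b g s / (Multiset.card s + 1) := fun b g s => by
    simp only [jetMul_apply]
    by_cases h : b ∈ s
    · have h2 : (Multiset.card (s.erase b) : ℂ) + 1 = Multiset.card s := by
        exact_mod_cast Multiset.card_erase_add_one h
      rw [← h2]
      ring_nf
    · rw [Multiset.count_eq_zero_of_notMem h]
      simp
  have h2 : ∑ b, jetMul b (jetDeriv a (G b)) = -G a := by
    have h3 : ∀ b, jetMul b (jetDeriv a (G b)) =
        jetDeriv a (jetMul b (G b)) - if a = b then G b else 0 := fun b => by
      rw [jetDeriv_jetMul, add_sub_cancel_right]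
    simp only [h3, Finset.sum_sub_distrib, ← map_sum, hG]
    simp
  ext s
  have h4 : ∀ b, jetMul b (fun s => (jetDeriv b (G a) s - jetDeriv a (G b) s) /
      (Multiset.card s + 2)) s =
        (jetMul b (jetDeriv b (G a)) s - jetMul b (jetDeriv a (G b)) s) /
          (Multiset.card s + 1) := fun b => by
    rw [h1 b (fun s => jetDeriv b (G a) s - jetDeriv a (G b) s) s]
    congr 1
    exact mul_sub _ _ _
  rw [Finset.sum_apply]
  simp only [h4]
  rw [← Finset.sum_div, Finset.sum_sub_distrib, ← Finset.sum_apply, ← Finset.sum_apply,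
    sum_jetMul_jetDeriv, h2, eq_div_iff (hne s), Pi.neg_apply]
  ring

end Jets

/-! ### Saturation of the star multiples of `x - μ` -/

section QuantumKoszul

variable {n : Type*}

/-- Multiplication of a formal series by the deformation parameter. -/
def shift : (ℕ → Jet (n × n)) →ₗ[ℂ] (ℕ → Jet (n × n)) where
  toFun F m := match m with
    | 0 => 0
    | m + 1 => F m
  map_add' F G := by ext1 m; cases m <;> simp
  map_smul' c F := by ext1 m; cases m <;> simp

theorem shift_zero (F : ℕ → Jet (n × n)) : shift F 0 = 0 := rfl

theorem shift_succ (F : ℕ → Jet (n × n)) (m : ℕ) : shift F (m + 1) = F m := rfl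

theorem shift_injective : Function.Injective (shift (n := n)) := fun _ _ h =>
  funext fun m => congrFun h (m + 1)

/-- A formal series with only a constant term. -/
def constSeries (g : Jet (n × n)) : ℕ → Jet (n × n)
  | 0 => g
  | _ + 1 => 0

theorem eq_constSeries_add_shift (F : ℕ → Jet (n × n)) :
    F = constSeries (F 0) + shift fun m => F (m + 1) := by
  ext1 m
  cases m <;> simp [constSeries, shift_zero, shift_succ]

theorem constSeries_sum {κ : Type*} [Fintype κ] (g : κ → Jet (n × n)) :
    constSeries (∑ b, g b) = ∑ b, constSeries (g b) := by
  ext1 m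
  cases m <;> simp [constSeries]

variable [DecidableEq n] (μ : ℂ)

/-- Multiplication by `x_{kl} = y_{kl} + μ δ_{kl}`. -/
def jetX (k l : n) : Jet (n × n) →ₗ[ℂ] Jet (n × n) :=
  jetMul (k, l) + (if k = l then μ else 0) • LinearMap.id

theorem jetX_apply (k l : n) (g : Jet (n × n)) :
    jetX μ k l g = jetMul (k, l) g + (if k = l then μ else 0) • g := rfl

theorem jetX_jetMul (k l : n) (a : n × n) (g : Jet (n × n)) :
    jetX μ k l (jetMul a g) = jetMul a (jetX μ k l g) := by
  simp only [jetX_apply, jetMul_comm _ a, map_add, map_smul]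

theorem jetDeriv_jetX (a : n × n) (k l : n) (g : Jet (n × n)) :
    jetDeriv a (jetX μ k l g) = jetX μ k l (jetDeriv a g) + if a = (k, l) then g else 0 := by
  simp only [jetX_apply, map_add, map_smul, jetDeriv_jetMul]
  abel

variable [Fintype n]

/-- The operator `∑_k x_{ki} ∂/∂x_{kj}`. -/
def jetEuler (i j : n) : Jet (n × n) →ₗ[ℂ] Jet (n × n) :=
  ∑ k, jetX μ k i ∘ₗ jetDeriv (k, j)

theorem jetEuler_apply (i j : n) (g : Jet (n × n)) :
    jetEuler μ i j g = ∑ k, jetX μ k i (jetDeriv (k, j) g) := by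
  simp [jetEuler, LinearMap.sum_apply]

theorem jetEuler_jetMul (i j l k : n) (g : Jet (n × n)) :
    jetEuler μ i j (jetMul (l, k) g) =
      jetMul (l, k) (jetEuler μ i j g) + if j = k then jetX μ l i g else 0 := by
  simp only [jetEuler_apply, jetDeriv_jetMul, map_add, Finset.sum_add_distrib, map_sum,
    jetX_jetMul, Prod.mk.injEq]
  congr 1
  by_cases h : j = k
  · simp only [h, and_true, if_true]
    rw [Finset.sum_eq_single l]
    · simp
    · intro b _ hb; simp [hb]
    · simp
  · simp [h]

theorem jetEuler_jetX (i j m k : n) (g : Jet (n × n)) :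
    jetEuler μ i j (jetX μ m k g) =
      jetX μ m k (jetEuler μ i j g) + if j = k then jetX μ m i g else 0 := by
  rw [jetX_apply, jetX_apply, map_add, map_smul, jetEuler_jetMul]
  abel

theorem jetDeriv_jetEuler (m l i j : n) (g : Jet (n × n)) :
    jetDeriv (m, l) (jetEuler μ i j g) =
      jetEuler μ i j (jetDeriv (m, l) g) + if l = i then jetDeriv (m, j) g else 0 := by
  simp only [jetEuler_apply, map_sum, jetDeriv_jetX, Finset.sum_add_distrib,
    jetDeriv_comm (m, l), Prod.mk.injEq]
  congr 1
  by_cases h : l = i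
  · simp only [h, and_true, if_true]
    rw [Finset.sum_eq_single m]
    · simp
    · intro b _ hb; simp [hb.symm]
    · simp
  · simp [h]

theorem jetEuler_jetEuler (i j k l : n) (g : Jet (n × n)) :
    jetEuler μ i j (jetEuler μ k l g) = jetEuler μ k l (jetEuler μ i j g) +
      (if j = k then jetEuler μ i l g else 0) - if l = i then jetEuler μ k j g else 0 := by
  have h1 : ∀ m, jetEuler μ i j (jetDeriv (m, l) g) = jetDeriv (m, l) (jetEuler μ i j g) -
      if l = i then jetDeriv (m, j) g else 0 := fun m => by
    rw [jetDeriv_jetEuler, add_sub_cancel_right]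
  rw [jetEuler_apply μ k l g, map_sum]
  simp only [jetEuler_jetX, h1, map_sub, Finset.sum_add_distrib, Finset.sum_sub_distrib]
  rw [← jetEuler_apply]
  split_ifs <;> simp [jetEuler_apply]
  abel

/-- The action `y_{ji} + λ ∑_k x_{ki} ∂/∂x_{kj}` on formal series of right star multiplication by
the component `(x - μ)_{ji}`. -/
def starMul (a : n × n) : (ℕ → Jet (n × n)) →ₗ[ℂ] (ℕ → Jet (n × n)) where
  toFun F m := jetMul a (F m) + shift (fun m => jetEuler μ a.2 a.1 (F m)) m
  map_add' F G := by
    ext1 m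
    cases m <;> simp [shift_zero, shift_succ, add_add_add_comm]
  map_smul' c F := by
    ext1 m
    cases m <;> simp [shift_zero, shift_succ]

theorem starMul_zero (a : n × n) (F : ℕ → Jet (n × n)) :
    starMul μ a F 0 = jetMul a (F 0) := by
  simp [starMul, shift_zero]

theorem starMul_succ (a : n × n) (F : ℕ → Jet (n × n)) (m : ℕ) :
    starMul μ a F (m + 1) = jetMul a (F (m + 1)) + jetEuler μ a.2 a.1 (F m) := rfl

/-- The operators `starMul` satisfy the commutation relations of `gl(p)`. The terms involving `μ`
cancel because the trace is a character of `gl(p)`. -/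
theorem starMul_starMul (j i l k : n) (F : ℕ → Jet (n × n)) :
    starMul μ (j, i) (starMul μ (l, k) F) - starMul μ (l, k) (starMul μ (j, i) F) =
      shift ((if j = k then starMul μ (l, i) F else 0) -
        if l = i then starMul μ (j, k) F else 0) := by
  have hx : ∀ g : Jet (n × n), (if j = k then jetX μ l i g else 0) -
      (if l = i then jetX μ j k g else 0) =
        (if j = k then jetMul (l, i) g else 0) - (if l = i then jetMul (j, k) g else 0) := by
    intro g
    simp only [jetX_apply]
    split_ifs <;> simp
  have hite : ∀ (c : Prop) [Decidable c] (G : ℕ → Jet (n × n)) (m : ℕ),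
      (if c then G else 0) m = if c then G m else 0 := fun c _ G m => by split_ifs <;> rfl
  ext1 m
  match m with
  | 0 =>
    simp [starMul_zero, shift_zero, jetMul_comm (j, i)]
  | 1 =>
    simp only [shift_succ, Pi.sub_apply, hite, starMul_succ, starMul_zero, map_add,
      jetEuler_jetMul, jetMul_comm (j, i) (l, k)]
    rw [← hx (F 0)]
    abel
  | m + 2 =>
    simp only [shift_succ, Pi.sub_apply, hite, starMul_succ, map_add,
      jetEuler_jetMul, jetMul_comm (j, i) (l, k), jetEuler_jetEuler μ i j k l]
    calc _ = ((if j = k then jetX μ l i (F (m + 1)) else 0) -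
          (if l = i then jetX μ j k (F (m + 1)) else 0)) +
          ((if j = k then jetEuler μ i l (F m) else 0) -
            if l = i then jetEuler μ k j (F m) else 0) := by abel
      _ = _ := by
        rw [hx]
        split_ifs <;> abel

/-- The formal series of the form `∑_a starMul a (G_a)`. -/
def starRange : Submodule ℂ (ℕ → Jet (n × n)) where
  carrier := {F | ∃ G : n × n → ℕ → Jet (n × n), F = ∑ a, starMul μ a (G a)}
  add_mem' := by
    rintro _ _ ⟨G, rfl⟩ ⟨G', rfl⟩
    exact ⟨G + G', by simp [Finset.sum_add_distrib]⟩
  zero_mem' := ⟨0, by simp⟩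
  smul_mem' := by
    rintro c _ ⟨G, rfl⟩
    exact ⟨c • G, by simp [Finset.smul_sum]⟩

theorem starMul_mem_starRange (a : n × n) (F : ℕ → Jet (n × n)) :
    starMul μ a F ∈ starRange μ := by
  refine ⟨Pi.single a F, ?_⟩
  rw [Finset.sum_eq_single a]
  · simp
  · intro b _ hb; simp [hb]
  · simp

theorem starMul_commutator_mem (a b : n × n) (F : ℕ → Jet (n × n)) :
    starMul μ a (starMul μ b F) - starMul μ b (starMul μ a F) ∈ (starRange μ).map shift := by
  obtain ⟨j, i⟩ := a
  obtain ⟨l, k⟩ := b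
  rw [starMul_starMul]
  refine Submodule.mem_map_of_mem (Submodule.sub_mem _ ?_ ?_)
  · split_ifs
    exacts [starMul_mem_starRange μ _ _, Submodule.zero_mem _]
  · split_ifs
    exacts [starMul_mem_starRange μ _ _, Submodule.zero_mem _]

theorem starMul_shift (a : n × n) (F : ℕ → Jet (n × n)) :
    starMul μ a (shift F) = shift (starMul μ a F) := by
  ext1 m
  match m with
  | 0 => simp [starMul_zero, shift_zero]
  | 1 => simp [starMul_succ, starMul_zero, shift_zero, shift_succ]
  | m + 2 => simp [starMul_succ, shift_succ]

theorem constSeries_jetMul (a : n × n) (g : Jet (n × n)) :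
    constSeries (jetMul a g) =
      starMul μ a (constSeries g) - shift (constSeries (jetEuler μ a.2 a.1 g)) := by
  ext1 m
  match m with
  | 0 => simp [starMul_zero, constSeries, shift_zero]
  | 1 => simp [starMul_succ, constSeries, shift_succ]
  | m + 2 => simp [starMul_succ, constSeries, shift_succ]

/-- The range of the star multiplications is saturated with respect to the deformation parameter.
The constant terms `G_a` of a representation of `λ F` satisfy `∑ y_a G_a = 0`, hence come from an
antisymmetric `A` by Koszul exactness, and the antisymmetry turns the leading part into
commutators, which are again divisible by `λ`. -/
theorem mem_starRange_of_shift_mem {F : ℕ → Jet (n × n)} (hF : shift F ∈ starRange μ) :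
    F ∈ starRange μ := by
  suffices h : shift F ∈ (starRange μ).map shift by
    obtain ⟨F', hF', he⟩ := h
    exact shift_injective he ▸ hF'
  obtain ⟨G, hG⟩ := hF
  have h0 : ∑ a, jetMul a (G a 0) = 0 := by
    have h := congrFun hG 0
    rw [shift_zero, Finset.sum_apply] at h
    simpa only [starMul_zero] using h.symm
  obtain ⟨A, hA, hGA⟩ := exists_antisymm_of_sum_jetMul_eq_zero h0
  have h1 : ∀ a, starMul μ a (G a) = ∑ b, starMul μ a (starMul μ b (constSeries (A a b))) -
      shift (starMul μ a (∑ b, constSeries (jetEuler μ b.2 b.1 (A a b)))) +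
      shift (starMul μ a fun m => G a (m + 1)) := fun a => by
    conv_lhs => rw [eq_constSeries_add_shift (G a), hGA a, constSeries_sum]
    simp only [constSeries_jetMul μ, Finset.sum_sub_distrib, map_add, map_sub, map_sum,
      starMul_shift]
  have h2 : ∑ a, ∑ b, starMul μ a (starMul μ b (constSeries (A a b))) =
      (2 : ℂ)⁻¹ • ∑ a, ∑ b, (starMul μ a (starMul μ b (constSeries (A a b))) -
        starMul μ b (starMul μ a (constSeries (A a b)))) := by
    have h3 : ∑ a, ∑ b, starMul μ b (starMul μ a (constSeries (A a b))) =
        -∑ a, ∑ b, starMul μ a (starMul μ b (constSeries (A a b))) := by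
      rw [Finset.sum_comm, ← Finset.sum_neg_distrib]
      refine Finset.sum_congr rfl fun a _ => ?_
      rw [← Finset.sum_neg_distrib]
      refine Finset.sum_congr rfl fun b _ => ?_
      have h4 : constSeries (A b a) = -constSeries (A a b) := by
        rw [hA b a]
        ext1 m
        cases m <;> simp [constSeries]
      rw [h4, map_neg, map_neg]
    simp only [Finset.sum_sub_distrib]
    rw [h3, sub_neg_eq_add, ← two_smul ℂ, smul_smul]
    simp
  rw [hG]
  simp only [h1, Finset.sum_add_distrib, Finset.sum_sub_distrib]
  rw [h2]
  refine Submodule.add_mem _ (Submodule.sub_mem _ (Submodule.smul_mem _ _ ?_) ?_) ?_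
  · exact Submodule.sum_mem _ fun a _ => Submodule.sum_mem _ fun b _ =>
      starMul_commutator_mem μ a b _
  · exact Submodule.sum_mem _ fun a _ => Submodule.mem_map_of_mem (starMul_mem_starRange μ a _)
  · exact Submodule.sum_mem _ fun a _ => Submodule.mem_map_of_mem (starMul_mem_starRange μ a _)

/-- The jet of a constant function. -/
def constJet (c : ℂ) : Jet (n × n) := fun s => if s = 0 then c else 0

theorem constJet_zero_of_mem_starRange {c : ℕ → ℂ}
    (hc : (fun m => constJet (c m)) ∈ starRange (n := n) μ) : c 0 = 0 := by
  obtain ⟨G, hG⟩ := hc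
  have h := congrFun (congrFun hG 0) 0
  rw [Finset.sum_apply, Finset.sum_apply] at h
  simpa [constJet, starMul_zero, jetMul_apply] using h

/-- The only formal series of constants of the form `∑_a starMul a (G_a)` is zero: its constant term
vanishes by evaluation at the origin, and the quotient by `λ` is of the same form by saturation. -/
theorem eq_zero_of_constJet_mem_starRange (m : ℕ) {c : ℕ → ℂ}
    (hc : (fun m => constJet (c m)) ∈ starRange (n := n) μ) : c m = 0 := by
  have h0 := constJet_zero_of_mem_starRange μ hc
  induction m generalizing c with
  | zero => exact h0
  | succ m ih =>
    have h1 : (fun m => constJet (c (m + 1))) ∈ starRange (n := n) μ := by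
      refine mem_starRange_of_shift_mem μ ?_
      have h2 : shift (fun m => constJet (c (m + 1))) = fun m => constJet (n := n) (c m) := by
        ext1 m
        cases m with
        | zero =>
          rw [shift_zero, h0]
          ext s
          simp [constJet]
        | succ m => rfl
      rwa [h2]
    exact ih h1 (constJet_zero_of_mem_starRange μ h1)

end QuantumKoszul

/-! ### Jets along the fibres of the level set `x = μ` -/

section FibreJets

variable {p q : ℕ}

/-- Evaluation of smooth functions at a point. -/
def evalAt (z : FullRank p q) : SmoothFun p q →+* ℂ :=
  (Pi.evalRingHom (fun _ : FullRank p q => ℂ) z).comp (SmoothFun p q).val.toRingHom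

theorem evalAt_apply (z : FullRank p q) (f : SmoothFun p q) : evalAt z f = f.1 z := rfl

/-- The value of `x = z† z` at a full rank matrix. -/
def gram (z : FullRank p q) : Matrix (Fin p) (Fin p) ℂ := (Matrix.of z.1)ᴴ * Matrix.of z.1

open scoped ComplexOrder in
theorem gram_posDef (z : FullRank p q) : (gram z).PosDef := by
  refine Matrix.PosDef.conjTranspose_mul_self _ ?_
  have h1 := LinearMap.finrank_range_add_finrank_ker (Matrix.of z.1).mulVecLin
  have h2 : Module.finrank ℂ (LinearMap.range (Matrix.of z.1).mulVecLin) = p := z.2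
  rw [h2, Module.finrank_fin_fun, Nat.add_eq_left, Submodule.finrank_eq_zero] at h1
  exact LinearMap.ker_eq_bot.mp h1

theorem xFun_map_evalAt (z : FullRank p q) : (xFun p q).map (evalAt z) = gram z := rfl

theorem isUnit_of_ne_zero {f : SmoothFun p q} (hf : ∀ z, f.1 z ≠ 0) : IsUnit f := by
  refine IsUnit.of_mul_eq_one ⟨fun z => (f.1 z)⁻¹, (contDiffOn_zeroExt_iff
    (g := fun z => (zeroExt f.1 z)⁻¹) fun z => by
      rw [zeroExt_apply]).mpr (f.2.inv fun z hz => ?_)⟩ ?_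
  · rw [zeroExt_apply f.1 ⟨z, hz⟩]
    exact hf _
  · ext z
    exact mul_inv_cancel₀ (hf z)

open scoped ComplexOrder in
theorem isUnit_det_xFun : IsUnit (xFun p q).det := by
  refine isUnit_of_ne_zero fun z => ?_
  rw [← evalAt_apply, RingHom.map_det, RingHom.mapMatrix_apply, xFun_map_evalAt]
  exact (gram_posDef z).det_pos.ne'

/-- The matrix `z` of smooth functions. -/
def zMat (p q : ℕ) : Matrix (Fin (p + q)) (Fin p) (SmoothFun p q) := Matrix.of fun A i => zFun A i

/-- The matrix `z†` of smooth functions. -/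
def zMatStar (p q : ℕ) : Matrix (Fin p) (Fin (p + q)) (SmoothFun p q) :=
  Matrix.of fun i A => zbarFun A i

/-- The matrix `z x⁻¹` of smooth functions, whose adjoint is the pseudoinverse of `z`. -/
def pinv (p q : ℕ) : Matrix (Fin (p + q)) (Fin p) (SmoothFun p q) :=
  zMat p q * (xFun p q)⁻¹

theorem pinv_mul_xFun : pinv p q * xFun p q = zMat p q := by
  rw [pinv, Matrix.mul_assoc, Matrix.nonsing_inv_mul _ isUnit_det_xFun, Matrix.mul_one]

theorem sum_pinv_mul_zbarFun (k m : Fin p) :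
    ∑ A, pinv p q A k * zbarFun A m = if m = k then 1 else 0 := by
  have h : zMatStar p q * zMat p q = xFun p q := by
    ext1 i j
    rw [Matrix.mul_apply, xFun_eq_sum]
    rfl
  have h2 : zMatStar p q * pinv p q = 1 := by
    rw [pinv, ← Matrix.mul_assoc, h, Matrix.mul_nonsing_inv _ isUnit_det_xFun]
  have h3 := congrFun (congrFun h2 m) k
  simpa [Matrix.mul_apply, Matrix.one_apply, zMatStar, mul_comm] using h3

/-- The vector field `W_{kj} = ∑_A (z x⁻¹)^A_k ∂/∂z^A_j`. These fields are dual to the functions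
`x_{kj}` and commute with each other: they are the coordinate fields `∂/∂x_{kj}` of the
complexified fibres, on which `z̄` is constant. -/
def fibreDeriv (a : Fin p × Fin p) : SmoothFun p q →ₗ[ℂ] SmoothFun p q where
  toFun f := ∑ A, pinv p q A a.1 * dz A a.2 f
  map_add' f g := by simp [mul_add, Finset.sum_add_distrib]
  map_smul' c f := by simp [Finset.smul_sum]

theorem fibreDeriv_apply (k j : Fin p) (f : SmoothFun p q) :
    fibreDeriv (k, j) f = ∑ A, pinv p q A k * dz A j f := rfl

theorem fibreDeriv_mul (a : Fin p × Fin p) (f g : SmoothFun p q) :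
    fibreDeriv a (f * g) = fibreDeriv a f * g + f * fibreDeriv a g := by
  obtain ⟨k, j⟩ := a
  simp only [fibreDeriv_apply, dz_mul, mul_add, Finset.sum_add_distrib, Finset.sum_mul,
    Finset.mul_sum, mul_assoc]
  congr 1
  exact Finset.sum_congr rfl fun A _ => mul_left_comm _ _ _

theorem fibreDeriv_xSub (μ : ℝ) (a b : Fin p × Fin p) :
    fibreDeriv a (xSub p q μ b.1 b.2) = if a = b then 1 else 0 := by
  obtain ⟨k, j⟩ := a
  obtain ⟨m, l⟩ := b
  simp only [fibreDeriv_apply, dz_xSub, Prod.mk.injEq]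
  by_cases h : j = l
  · simp [h, sum_pinv_mul_zbarFun, eq_comm]
  · simp [h]

theorem fibreDeriv_xFun (k j m l : Fin p) :
    fibreDeriv (k, j) (xFun p q m l) = if k = m ∧ j = l then 1 else 0 := by
  have h := fibreDeriv_xSub (p := p) (q := q) 0 (k, j) (m, l)
  rw [xSub_apply] at h
  simpa using h

/-- This follows from differentiating `pinv * x = z`. -/
theorem fibreDeriv_pinv (a : Fin p × Fin p) (B : Fin (p + q)) (m : Fin p) :
    fibreDeriv a (pinv p q B m) = 0 := by
  obtain ⟨k, j⟩ := a
  have h1 : ∀ l, ∑ m, fibreDeriv (k, j) (pinv p q B m) * xFun p q m l = 0 := fun l => by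
    have h2 : ∑ m, pinv p q B m * xFun p q m l = zFun B l := by
      rw [← Matrix.mul_apply, pinv_mul_xFun]
      rfl
    have h3 := congrArg (fibreDeriv (k, j)) h2
    have h4 : fibreDeriv (k, j) (zFun B l) = if j = l then pinv p q B k else 0 := by
      rw [fibreDeriv_apply]
      simp only [dz_zFun]
      rw [Finset.sum_eq_single B]
      · simp
      · intro b _ hb; simp [hb]
      · simp
    have h5 : ∑ m, pinv p q B m * fibreDeriv (k, j) (xFun p q m l) =
        if j = l then pinv p q B k else 0 := by
      simp only [fibreDeriv_xFun]
      rw [Finset.sum_eq_single k]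
      · simp
      · intro b _ hb; simp [hb.symm]
      · simp
    rw [h4, map_sum] at h3
    simp only [fibreDeriv_mul, Finset.sum_add_distrib, h5] at h3
    simpa using h3
  have h2 : (fun m => fibreDeriv (k, j) (pinv p q B m)) ᵥ* xFun p q = 0 := funext h1
  have h3 := congrArg (fun v => v ᵥ* (xFun p q)⁻¹) h2
  simp only [Matrix.vecMul_vecMul, Matrix.mul_nonsing_inv _ isUnit_det_xFun, Matrix.vecMul_one,
    Matrix.zero_vecMul] at h3
  exact congrFun h3 m

theorem fibreDeriv_comm (a b : Fin p × Fin p) (f : SmoothFun p q) :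
    fibreDeriv a (fibreDeriv b f) = fibreDeriv b (fibreDeriv a f) := by
  have h : ∀ a b : Fin p × Fin p, fibreDeriv a (fibreDeriv b f) =
      ∑ A, ∑ B, pinv p q A a.1 * pinv p q B b.1 * dz A a.2 (dz B b.2 f) := fun a b => by
    rw [show fibreDeriv b f = ∑ B, pinv p q B b.1 * dz B b.2 f from rfl, map_sum]
    simp only [fibreDeriv_mul, fibreDeriv_pinv, zero_mul, zero_add]
    rw [Finset.sum_comm]
    refine Finset.sum_congr rfl fun B _ => ?_
    rw [show fibreDeriv a (dz B b.2 f) = ∑ A, pinv p q A a.1 * dz A a.2 (dz B b.2 f) from rfl,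
      Finset.mul_sum]
    exact Finset.sum_congr rfl fun A _ => by ring
  rw [h, h, Finset.sum_comm]
  refine Finset.sum_congr rfl fun A _ => Finset.sum_congr rfl fun B _ => ?_
  rw [dz_dz_comm, mul_comm (pinv p q B a.1)]

instance : LeftCommutative fun (a : Fin p × Fin p) (f : SmoothFun p q) => fibreDeriv a f :=
  ⟨fibreDeriv_comm⟩

/-- The iterated fibre derivative, which does not depend on the order of the derivatives. -/
def fibreDerivs (s : Multiset (Fin p × Fin p)) (f : SmoothFun p q) : SmoothFun p q :=
  s.foldr (fun a f => fibreDeriv a f) f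

theorem fibreDerivs_zero (f : SmoothFun p q) : fibreDerivs 0 f = f := rfl

theorem fibreDerivs_cons (a : Fin p × Fin p) (s : Multiset (Fin p × Fin p))
    (f : SmoothFun p q) : fibreDerivs (a ::ₘ s) f = fibreDeriv a (fibreDerivs s f) :=
  Multiset.foldr_cons _ _ _ _

theorem fibreDerivs_add (s : Multiset (Fin p × Fin p)) (f g : SmoothFun p q) :
    fibreDerivs s (f + g) = fibreDerivs s f + fibreDerivs s g := by
  induction s using Multiset.induction_on with
  | empty => rfl
  | cons a s ih => simp only [fibreDerivs_cons, ih, map_add]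

theorem fibreDerivs_smul (s : Multiset (Fin p × Fin p)) (c : ℂ) (f : SmoothFun p q) :
    fibreDerivs s (c • f) = c • fibreDerivs s f := by
  induction s using Multiset.induction_on with
  | empty => rfl
  | cons a s ih => simp only [fibreDerivs_cons, ih, map_smul]

theorem fibreDerivs_fibreDeriv (a : Fin p × Fin p) (s : Multiset (Fin p × Fin p))
    (f : SmoothFun p q) : fibreDerivs s (fibreDeriv a f) = fibreDerivs (a ::ₘ s) f := by
  induction s using Multiset.induction_on with
  | empty => rfl
  | cons b s ih => rw [fibreDerivs_cons, ih, Multiset.cons_swap, fibreDerivs_cons b]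

theorem fibreDerivs_xSub_mul (μ : ℝ) (b : Fin p × Fin p) (s : Multiset (Fin p × Fin p))
    (f : SmoothFun p q) :
    fibreDerivs s (xSub p q μ b.1 b.2 * f) = xSub p q μ b.1 b.2 * fibreDerivs s f +
      (s.count b : ℂ) • fibreDerivs (s.erase b) f := by
  induction s using Multiset.induction_on with
  | empty => simp [fibreDerivs_zero]
  | cons a s ih =>
    rw [fibreDerivs_cons, ih, map_add, map_smul, fibreDeriv_mul, fibreDeriv_xSub,
      ← fibreDerivs_cons, ← fibreDerivs_cons]
    by_cases h : a = b
    · subst h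
      rw [Multiset.count_cons_self, Multiset.erase_cons_head, if_pos rfl, one_mul]
      by_cases hs : a ∈ s
      · rw [Multiset.cons_erase hs]
        push_cast
        module
      · rw [Multiset.count_eq_zero_of_notMem hs]
        simp [add_comm]
    · rw [Multiset.count_cons_of_ne (Ne.symm h), Multiset.erase_cons_tail _ h, if_neg h]
      simp

/-- The Taylor expansion of a smooth function along the fibre through `z`, in the coordinates
`x - μ`. -/
def fibreJet (z : FullRank p q) : SmoothFun p q →ₗ[ℂ] Jet (Fin p × Fin p) where
  toFun f s := (fibreDerivs s f).1 z
  map_add' f g := by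
    ext s
    rw [fibreDerivs_add]
    rfl
  map_smul' c f := by
    ext s
    rw [fibreDerivs_smul]
    rfl

theorem fibreJet_apply (z : FullRank p q) (f : SmoothFun p q) (s : Multiset (Fin p × Fin p)) :
    fibreJet z f s = (fibreDerivs s f).1 z := rfl

theorem fibreJet_fibreDeriv (z : FullRank p q) (a : Fin p × Fin p) (f : SmoothFun p q) :
    fibreJet z (fibreDeriv a f) = jetDeriv a (fibreJet z f) := by
  ext s
  rw [fibreJet_apply, fibreDerivs_fibreDeriv]
  rfl

theorem fibreJet_xSub_mul {μ : ℝ} {z : FullRank p q} (hz : gram z = Matrix.scalar (Fin p) (μ : ℂ))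
    (b : Fin p × Fin p) (f : SmoothFun p q) :
    fibreJet z (xSub p q μ b.1 b.2 * f) = jetMul b (fibreJet z f) := by
  have h : (xSub p q μ b.1 b.2).1 z = 0 := by
    have h1 := congrFun (congrFun (xSub_val μ z) b.1) b.2
    rw [show (Matrix.of z.1)ᴴ * Matrix.of z.1 = gram z from rfl, hz, sub_self] at h1
    exact h1
  ext s
  rw [fibreJet_apply, fibreDerivs_xSub_mul, jetMul_apply, fibreJet_apply]
  simp [h]

theorem fibreJet_xFun_mul {μ : ℝ} {z : FullRank p q} (hz : gram z = Matrix.scalar (Fin p) (μ : ℂ))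
    (k l : Fin p) (f : SmoothFun p q) :
    fibreJet z (xFun p q k l * f) = jetX (μ : ℂ) k l (fibreJet z f) := by
  have h : xFun p q k l * f = xSub p q μ k l * f + (if k = l then (μ : ℂ) else 0) • f := by
    rw [xSub_apply, Algebra.smul_def]
    ring
  rw [h, map_add, map_smul, fibreJet_xSub_mul hz (k, l), jetX_apply]

theorem euler_eq_sum_fibreDeriv (i j : Fin p) (f : SmoothFun p q) :
    euler i j f = ∑ k, xFun p q k i * fibreDeriv (k, j) f := by
  have h : ∀ A, zFun A i = ∑ k, pinv p q A k * xFun p q k i := fun A => by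
    rw [← Matrix.mul_apply, pinv_mul_xFun]
    rfl
  simp only [euler, h, fibreDeriv_apply, Finset.sum_mul, Finset.mul_sum]
  rw [Finset.sum_comm]
  exact Finset.sum_congr rfl fun k _ => Finset.sum_congr rfl fun A _ => by ring

theorem fibreDeriv_eq_sum_euler (k j : Fin p) (f : SmoothFun p q) :
    fibreDeriv (k, j) f = ∑ i, (xFun p q)⁻¹ i k * euler i j f := by
  simp only [euler, fibreDeriv_apply, pinv, Matrix.mul_apply, zMat, Finset.sum_mul,
    Finset.mul_sum, Matrix.of_apply]
  rw [Finset.sum_comm]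
  exact Finset.sum_congr rfl fun k _ => Finset.sum_congr rfl fun A _ => by ring

theorem fibreJet_euler {μ : ℝ} {z : FullRank p q} (hz : gram z = Matrix.scalar (Fin p) (μ : ℂ))
    (i j : Fin p) (f : SmoothFun p q) :
    fibreJet z (euler i j f) = jetEuler (μ : ℂ) i j (fibreJet z f) := by
  rw [euler_eq_sum_fibreDeriv, map_sum, jetEuler_apply]
  simp only [fibreJet_xFun_mul hz, fibreJet_fibreDeriv]

theorem fibreJet_of_homogeneous {f : SmoothFun p q} (hf : f ∈ homogeneousFun p q)
    (z : FullRank p q) : fibreJet z f = constJet (f.1 z) := by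
  ext s
  rw [fibreJet_apply, constJet]
  induction s using Multiset.induction_on with
  | empty => simp [fibreDerivs_zero]
  | cons a s ih =>
    have h0 : ∀ s, fibreDerivs s (0 : SmoothFun p q) = 0 := fun s => by
      have h := fibreDerivs_smul s (0 : ℂ) (0 : SmoothFun p q)
      rwa [zero_smul, zero_smul] at h
    rw [← fibreDerivs_fibreDeriv, show a = (a.1, a.2) from rfl, fibreDeriv_eq_sum_euler]
    simp [euler_eq_zero hf, h0]

/-- A homogeneous series in the star ideal vanishes on the level set `x = μ`. -/
theorem coeff_eq_zero_of_mem_starIdeal {μ : ℝ} {H : Series p q} (hH : H ∈ Hom p q)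
    (hI : H ∈ starIdeal p q μ) {z : FullRank p q}
    (hz : gram z = Matrix.scalar (Fin p) (μ : ℂ)) (m : ℕ) :
    (PowerSeries.coeff m H).1 z = 0 := by
  obtain ⟨G, -, rfl⟩ := hI
  refine eq_zero_of_constJet_mem_starRange (n := Fin p) (μ : ℂ) m
    (c := fun m => (PowerSeries.coeff m (pairing p q μ G)).1 z)
    ⟨fun a m => fibreJet z (PowerSeries.coeff m (G a.2 a.1)), ?_⟩
  ext1 m
  rw [← fibreJet_of_homogeneous (hH m), Finset.sum_apply, Fintype.sum_prod_type, Finset.sum_comm]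
  cases m with
  | zero =>
    simp only [coeff_zero_pairing, map_sum, starMul_zero]
    refine Finset.sum_congr rfl fun i _ => Finset.sum_congr rfl fun j _ => ?_
    rw [mul_comm, fibreJet_xSub_mul hz (j, i)]
  | succ m =>
    simp only [coeff_succ_pairing, map_sum, map_add, starMul_succ, fibreJet_euler hz]
    refine Finset.sum_congr rfl fun i _ => Finset.sum_congr rfl fun j _ => ?_
    rw [mul_comm, fibreJet_xSub_mul hz (j, i)]

end FibreJets

/-! ### Smooth dependence of integrals on parameters -/

section ParametricIntegral

open MeasureTheory

variable {E : Type} [NormedAddCommGroup E]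

theorem exists_ball_bound [ProperSpace E] {F : Type} [NormedAddCommGroup F]
    {U : Set (ℝ × E)} {Z : Set E} (hZ : IsOpen Z) (hUZ : Set.Icc (0 : ℝ) 1 ×ˢ Z ⊆ U)
    {φ : ℝ × E → F} (hφ : ContinuousOn φ U) {z : E} (hz : z ∈ Z) :
    ∃ r > 0, Metric.ball z r ⊆ Z ∧ ∃ C, ∀ t ∈ Set.Icc (0 : ℝ) 1, ∀ w ∈ Metric.ball z r,
      ‖φ (t, w)‖ ≤ C := by
  obtain ⟨r, hr, hrZ⟩ := Metric.nhds_basis_closedBall.mem_iff.mp (hZ.mem_nhds hz)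
  obtain ⟨C, hC⟩ := (isCompact_Icc.prod (isCompact_closedBall z r)).exists_bound_of_continuousOn
    (hφ.mono ((Set.prod_mono_right hrZ).trans hUZ))
  exact ⟨r, hr, Metric.ball_subset_closedBall.trans hrZ, C, fun t ht w hw =>
    hC (t, w) ⟨ht, Metric.ball_subset_closedBall hw⟩⟩

theorem continuousOn_slice {F : Type} [NormedAddCommGroup F] {U : Set (ℝ × E)} {Z : Set E}
    (hUZ : Set.Icc (0 : ℝ) 1 ×ˢ Z ⊆ U) {φ : ℝ × E → F} (hφ : ContinuousOn φ U)
    {z : E} (hz : z ∈ Z) : ContinuousOn (fun t => φ (t, z)) (Set.uIcc 0 1) := by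
  refine hφ.comp (by fun_prop) fun t ht => hUZ ⟨?_, hz⟩
  rwa [Set.uIcc_of_le zero_le_one] at ht

theorem uIoc_zero_one_subset : Set.uIoc (0 : ℝ) 1 ⊆ Set.Icc 0 1 := by
  rw [Set.uIoc_of_le zero_le_one]
  exact Set.Ioc_subset_Icc_self

theorem aestronglyMeasurable_slice {F : Type} [NormedAddCommGroup F] {U : Set (ℝ × E)}
    {Z : Set E} (hUZ : Set.Icc (0 : ℝ) 1 ×ˢ Z ⊆ U) {φ : ℝ × E → F}
    (hφ : ContinuousOn φ U) {z : E} (hz : z ∈ Z) :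
    AEStronglyMeasurable (fun t => φ (t, z)) (volume.restrict (Set.uIoc 0 1)) :=
  (intervalIntegrable_iff.mp
    (continuousOn_slice hUZ hφ hz).intervalIntegrable).aestronglyMeasurable

variable [ProperSpace E]

theorem continuousOn_integral_param {F : Type} [NormedAddCommGroup F] [NormedSpace ℝ F]
    {U : Set (ℝ × E)} {Z : Set E} (hZ : IsOpen Z) (hUZ : Set.Icc (0 : ℝ) 1 ×ˢ Z ⊆ U)
    {φ : ℝ × E → F} (hφ : ContinuousOn φ U) (hU : IsOpen U) :
    ContinuousOn (fun z => ∫ t in (0 : ℝ)..1, φ (t, z)) Z := by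
  intro z hz
  obtain ⟨r, hr, hrZ, C, hC⟩ := exists_ball_bound hZ hUZ hφ hz
  refine (intervalIntegral.continuousAt_of_dominated_interval (bound := fun _ => C)
    ?_ ?_ (by simp) ?_).continuousWithinAt
  · filter_upwards [hZ.mem_nhds hz] with w hw using aestronglyMeasurable_slice hUZ hφ hw
  · filter_upwards [Metric.ball_mem_nhds z hr] with w hw
    exact Filter.Eventually.of_forall fun t ht => hC t (uIoc_zero_one_subset ht) w hw
  · refine Filter.Eventually.of_forall fun t ht => ?_
    exact ContinuousAt.comp (f := fun w => (t, w)) (hφ.continuousAt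
      (hU.mem_nhds (hUZ ⟨uIoc_zero_one_subset ht, hz⟩))) (by fun_prop)

variable [NormedSpace ℝ E]

theorem hasFDerivAt_integral_param {F : Type} [NormedAddCommGroup F] [NormedSpace ℝ F]
    {U : Set (ℝ × E)} {Z : Set E} (hZ : IsOpen Z) (hUZ : Set.Icc (0 : ℝ) 1 ×ˢ Z ⊆ U)
    {φ : ℝ × E → F} (hU : IsOpen U) (hφ : ContDiffOn ℝ 1 φ U) {z : E} (hz : z ∈ Z) :
    HasFDerivAt (fun z => ∫ t in (0 : ℝ)..1, φ (t, z))
      (∫ t in (0 : ℝ)..1, (fderiv ℝ φ (t, z)).comp (ContinuousLinearMap.inr ℝ ℝ E)) z := by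
  have hd : ContinuousOn (fun x => (fderiv ℝ φ x).comp (ContinuousLinearMap.inr ℝ ℝ E)) U :=
    (hφ.continuousOn_fderiv_of_isOpen hU (by simp)).clm_comp continuousOn_const
  obtain ⟨r, hr, hrZ, C, hC⟩ := exists_ball_bound hZ hUZ hd hz
  refine intervalIntegral.hasFDerivAt_integral_of_dominated_of_fderiv_le (𝕜 := ℝ)
    (F := fun z t => φ (t, z))
    (F' := fun z t => (fderiv ℝ φ (t, z)).comp (ContinuousLinearMap.inr ℝ ℝ E))
    (bound := fun _ => C) (Metric.ball_mem_nhds z hr) ?_ ?_ ?_ ?_ (by simp) ?_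
  · filter_upwards [hZ.mem_nhds hz] with w hw using
      aestronglyMeasurable_slice hUZ hφ.continuousOn hw
  · exact (continuousOn_slice hUZ hφ.continuousOn hz).intervalIntegrable
  · exact aestronglyMeasurable_slice hUZ hd hz
  · exact Filter.Eventually.of_forall fun t ht w hw => hC t (uIoc_zero_one_subset ht) w hw
  · refine Filter.Eventually.of_forall fun t ht w hw => ?_
    have h1 : HasFDerivAt φ (fderiv ℝ φ (t, w)) (t, w) :=
      ((hφ.contDiffAt (hU.mem_nhds (hUZ ⟨uIoc_zero_one_subset ht, hrZ hw⟩))).differentiableAt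
        (by simp)).hasFDerivAt
    exact h1.comp w (hasFDerivAt_prodMk_right t w)

/-- The integral over `[0, 1]` of a smooth function of `(t, z)` is a smooth function of `z`. -/
theorem contDiffOn_integral_param {F : Type} [NormedAddCommGroup F] [NormedSpace ℝ F]
    {U : Set (ℝ × E)} {Z : Set E} (hZ : IsOpen Z) (hUZ : Set.Icc (0 : ℝ) 1 ×ˢ Z ⊆ U)
    (hU : IsOpen U) {φ : ℝ × E → F} (hφ : ContDiffOn ℝ ∞ φ U) :
    ContDiffOn ℝ ∞ (fun z => ∫ t in (0 : ℝ)..1, φ (t, z)) Z := by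
  rw [contDiffOn_infty]
  intro n
  induction n generalizing F with
  | zero =>
    exact contDiffOn_zero.mpr (continuousOn_integral_param hZ hUZ hφ.continuousOn hU)
  | succ n ih =>
    have hφ1 : ContDiffOn ℝ 1 φ U := hφ.of_le (by simp)
    rw [Nat.cast_succ, contDiffOn_succ_iff_fderiv_of_isOpen hZ]
    refine ⟨fun z hz => (hasFDerivAt_integral_param hZ hUZ hU hφ1
      hz).differentiableAt.differentiableWithinAt, by simp, ?_⟩
    have h := ih (φ := fun x => (fderiv ℝ φ x).comp (ContinuousLinearMap.inr ℝ ℝ E))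
      ((hφ.fderiv_of_isOpen hU (m := ∞) (by simp)).clm_comp contDiffOn_const)
    exact h.congr fun z hz => (hasFDerivAt_integral_param hZ hUZ hU hφ1 hz).fderiv

end ParametricIntegral

/-! ### Smooth matrix-valued maps -/

section MatrixCalculus

variable {E : Type} [NormedAddCommGroup E] [NormedSpace ℝ E] {k l m : ℕ}

/-- Smoothness at a point of a matrix-valued map, expressed by its entries because `Matrix` carries
no norm. -/
def MatSmoothAt (M : E → Matrix (Fin k) (Fin l) ℂ) (z : E) : Prop :=
  ∀ i j, ContDiffAt ℝ ∞ (fun w => M w i j) z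

theorem MatSmoothAt.mul {M : E → Matrix (Fin k) (Fin l) ℂ} {N : E → Matrix (Fin l) (Fin m) ℂ}
    {z : E} (hM : MatSmoothAt M z) (hN : MatSmoothAt N z) :
    MatSmoothAt (fun w => M w * N w) z := fun i j => by
  simp only [Matrix.mul_apply]
  exact ContDiffAt.sum fun a _ => (hM i a).mul (hN a j)

theorem MatSmoothAt.add {M N : E → Matrix (Fin k) (Fin l) ℂ}
    {z : E} (hM : MatSmoothAt M z) (hN : MatSmoothAt N z) :
    MatSmoothAt (fun w => M w + N w) z := fun i j => (hM i j).add (hN i j)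

theorem MatSmoothAt.smul {c : E → ℂ} {M : E → Matrix (Fin k) (Fin l) ℂ}
    {z : E} (hc : ContDiffAt ℝ ∞ c z) (hM : MatSmoothAt M z) :
    MatSmoothAt (fun w => c w • M w) z := fun i j => hc.mul (hM i j)

theorem MatSmoothAt.const (M : Matrix (Fin k) (Fin l) ℂ) (z : E) :
    MatSmoothAt (fun _ => M) z := fun _ _ => contDiffAt_const

theorem MatSmoothAt.conjTranspose {M : E → Matrix (Fin k) (Fin l) ℂ} {z : E}
    (hM : MatSmoothAt M z) : MatSmoothAt (fun w => (M w)ᴴ) z := fun i j =>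
  Complex.conjCLE.contDiff.contDiffAt.comp z (hM j i)

theorem MatSmoothAt.comp {E' : Type} [NormedAddCommGroup E'] [NormedSpace ℝ E']
    {M : E → Matrix (Fin k) (Fin l) ℂ} {g : E' → E} {z : E'} (hM : MatSmoothAt M (g z))
    (hg : ContDiffAt ℝ ∞ g z) : MatSmoothAt (fun w => M (g w)) z := fun i j =>
  (hM i j).comp z hg

theorem matSmoothAt_iff {M : E → Matrix (Fin k) (Fin l) ℂ} {z : E} :
    MatSmoothAt M z ↔ ContDiffAt ℝ ∞ (fun w => Matrix.of.symm (M w)) z := by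
  rw [contDiffAt_pi]
  exact forall_congr' fun i => contDiffAt_pi.symm

theorem MatSmoothAt.det {M : E → Matrix (Fin k) (Fin k) ℂ} {z : E} (hM : MatSmoothAt M z) :
    ContDiffAt ℝ ∞ (fun w => (M w).det) z := by
  simp only [Matrix.det_apply, Units.smul_def, zsmul_eq_mul]
  exact ContDiffAt.sum fun σ _ => contDiffAt_const.mul (contDiffAt_prod fun i _ => hM _ _)

theorem MatSmoothAt.inv {M : E → Matrix (Fin k) (Fin k) ℂ} {z : E} (hM : MatSmoothAt M z)
    (h0 : (M z).det ≠ 0) : MatSmoothAt (fun w => (M w)⁻¹) z := by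
  simp only [Matrix.inv_def, Ring.inverse_eq_inv']
  refine MatSmoothAt.smul (hM.det.inv h0) fun i j => ?_
  simp only [Matrix.adjugate_apply]
  refine MatSmoothAt.det fun a b => ?_
  simp only [Matrix.updateRow_apply]
  split_ifs
  exacts [contDiffAt_const, hM a b]

end MatrixCalculus

/-! ### The normalization of full rank matrices -/

section SquareRoot

open scoped ComplexOrder MatrixOrder

variable {p q : ℕ}

/-- The traces of the positive semidefinite matrices `k† h k` and `k h k†` add up to zero. -/
theorem eq_zero_of_posDef_anticomm {h k : Matrix (Fin p) (Fin p) ℂ} (hh : h.PosDef)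
    (hk : h * k + k * h = 0) : k = 0 := by
  have h1 : (kᴴ * h * k).trace + (k * h * kᴴ).trace = 0 := by
    have h2 : (k * h * kᴴ).trace = (kᴴ * (k * h)).trace := Matrix.trace_mul_comm _ _
    rw [h2, Matrix.mul_assoc, ← Matrix.trace_add, ← Matrix.mul_add, hk]
    simp
  have h3 : (kᴴ * h * k).PosSemidef := hh.posSemidef.conjTranspose_mul_mul_same k
  have h4 : (k * h * kᴴ).PosSemidef := hh.posSemidef.mul_mul_conjTranspose_same k
  have h5 : (kᴴ * h * k).trace = 0 :=
    ((add_eq_zero_iff_of_nonneg h3.trace_nonneg h4.trace_nonneg).mp h1).1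
  have h6 := h3.trace_eq_zero_iff.mp h5
  refine Matrix.ext_of_mulVec_single fun i => ?_
  rw [Matrix.zero_mulVec]
  by_contra hne
  have h7 := hh.dotProduct_mulVec_pos hne
  have h8 : star (k *ᵥ Pi.single i 1) ⬝ᵥ (h *ᵥ (k *ᵥ Pi.single i 1)) =
      star (Pi.single i (1 : ℂ)) ⬝ᵥ ((kᴴ * h * k) *ᵥ Pi.single i 1) := by
    rw [Matrix.star_mulVec, ← Matrix.dotProduct_mulVec, Matrix.mulVec_mulVec, Matrix.mulVec_mulVec,
      Matrix.mul_assoc]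
  rw [h8, h6] at h7
  simp at h7

/-- Squaring is a local diffeomorphism at a positive definite matrix: there is a smooth local left
inverse. -/
theorem exists_local_sqrt {h : Matrix (Fin p) (Fin p) ℂ} (hh : h.PosDef) :
    ∃ σ : (Fin p → Fin p → ℂ) → Matrix (Fin p) (Fin p) ℂ, MatSmoothAt σ (Matrix.of.symm (h * h)) ∧
      ∀ᶠ k in nhds h, σ (Matrix.of.symm (k * k)) = k := by
  open scoped Matrix.Norms.L2Operator in
  let L : Matrix (Fin p) (Fin p) ℂ →ₗ[ℝ] Matrix (Fin p) (Fin p) ℂ :=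
    LinearMap.mulLeft ℝ h + LinearMap.mulRight ℝ h
  have hL : Function.Injective L := by
    rw [injective_iff_map_eq_zero]
    exact fun k hk => eq_zero_of_posDef_anticomm hh hk
  let e := (LinearEquiv.ofInjectiveEndo L hL).toContinuousLinearEquiv
  have h1 : ContDiffAt ℝ ∞ (fun k : Matrix (Fin p) (Fin p) ℂ => k * k) h :=
    contDiffAt_id.mul contDiffAt_id
  have h2 : HasStrictFDerivAt (fun k : Matrix (Fin p) (Fin p) ℂ => k * k)
      (e : Matrix (Fin p) (Fin p) ℂ →L[ℝ] Matrix (Fin p) (Fin p) ℂ) h := by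
    refine ((hasStrictFDerivAt_id h).mul' (hasStrictFDerivAt_id h)).congr_fderiv ?_
    ext1 k
    rfl
  have hj : ContDiff ℝ ∞ (fun w : Fin p → Fin p → ℂ => Matrix.of w) :=
    (LinearMap.toContinuousLinearMap ({ toFun := fun w => Matrix.of w
                                        map_add' := fun _ _ => rfl
                                        map_smul' := fun _ _ => rfl } :
      (Fin p → Fin p → ℂ) →ₗ[ℝ] Matrix (Fin p) (Fin p) ℂ)).contDiff
  have hent : ∀ i j, ContDiff ℝ ∞ (fun w : Matrix (Fin p) (Fin p) ℂ => w i j) := fun i j =>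
    (LinearMap.toContinuousLinearMap ({ toFun := fun w => w i j
                                        map_add' := fun _ _ => rfl
                                        map_smul' := fun _ _ => rfl } :
      Matrix (Fin p) (Fin p) ℂ →ₗ[ℝ] ℂ)).contDiff
  refine ⟨fun w => h1.localInverse h2.hasFDerivAt (by simp) (Matrix.of w), fun i j => ?_, ?_⟩
  · have h3 := h1.to_localInverse h2.hasFDerivAt (by simp)
    exact (hent i j).contDiffAt.comp _ (ContDiffAt.comp (g := h1.localInverse h2.hasFDerivAt
      (by simp)) _ h3 hj.contDiffAt)
  · exact (h1.hasStrictFDerivAt' h2.hasFDerivAt (by simp)).eventually_left_inverse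

theorem sqrt_posDef {y : Matrix (Fin p) (Fin p) ℂ} (hy : y.PosDef) : (CFC.sqrt y).PosDef := by
  have h1 : CFC.sqrt y * CFC.sqrt y = y := CFC.sqrt_mul_sqrt_self y hy.posSemidef.nonneg
  rw [(Matrix.nonneg_iff_posSemidef.mp (CFC.sqrt_nonneg y)).posDef_iff_isUnit]
  have h2 : IsUnit (CFC.sqrt y * CFC.sqrt y) := by
    rw [h1]
    exact hy.isUnit
  rw [Matrix.isUnit_iff_isUnit_det] at h2 ⊢
  rw [Matrix.det_mul] at h2
  exact isUnit_of_mul_isUnit_left h2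

theorem continuousOn_sqrt :
    ContinuousOn (fun y : Matrix (Fin p) (Fin p) ℂ => CFC.sqrt y) {y | 0 ≤ y} := by
  open scoped Matrix.Norms.L2Operator in
  have h := ContinuousOn.cfc_nnreal_of_mem_nhdsSet (s := Set.univ) NNReal.sqrt
    (a := fun y : Matrix (Fin p) (Fin p) ℂ => y) (t := {y | 0 ≤ y}) Filter.univ_mem
    continuousOn_id (fun _ h => h) NNReal.continuous_sqrt.continuousOn
  exact h.congr fun y hy => CFC.sqrt_eq_cfc

/-- The positive square root of `z† z`. -/
def gramSqrt (z : Mat p q) : Matrix (Fin p) (Fin p) ℂ :=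
  CFC.sqrt ((Matrix.of z)ᴴ * Matrix.of z)

theorem matSmoothAt_of {k l : ℕ} (z : Fin k → Fin l → ℂ) :
    MatSmoothAt (fun w : Fin k → Fin l → ℂ => Matrix.of w) z := fun i j =>
  (contDiff_apply_apply ℝ ℂ i j).contDiffAt

/-- The square root is continuous by the continuity of the functional calculus, hence it agrees
locally with the smooth local inverse of squaring. -/
theorem matSmoothAt_gramSqrt (z : FullRank p q) :
    MatSmoothAt (fun w : Mat p q => gramSqrt w) z.1 := by
  have hg : MatSmoothAt (fun w : Mat p q => (Matrix.of w)ᴴ * Matrix.of w) z.1 :=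
    (matSmoothAt_of z.1).conjTranspose.mul (matSmoothAt_of z.1)
  have h0 : ∀ w : Mat p q, 0 ≤ (Matrix.of w)ᴴ * Matrix.of w := fun w =>
    (Matrix.posSemidef_conjTranspose_mul_self _).nonneg
  have hs : ∀ w : Mat p q, gramSqrt w * gramSqrt w = (Matrix.of w)ᴴ * Matrix.of w := fun w =>
    CFC.sqrt_mul_sqrt_self _ (h0 w)
  have hp : (gramSqrt z.1).PosDef := sqrt_posDef (gram_posDef z)
  obtain ⟨σ, hσ, hσ'⟩ := exists_local_sqrt hp
  have hc : ContinuousAt (fun w : Mat p q => gramSqrt w) z.1 := by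
    have h1 : Continuous (fun w : Mat p q => (Matrix.of w)ᴴ * Matrix.of w) := by
      have hc : Continuous fun z : Mat p q => Matrix.of z := continuous_id
      exact hc.matrix_conjTranspose.matrix_mul hc
    exact (continuousOn_sqrt.comp_continuous h1 h0).continuousAt
  have h1 : MatSmoothAt (fun w : Mat p q => σ (Matrix.of.symm ((Matrix.of w)ᴴ * Matrix.of w)))
      z.1 := by
    refine MatSmoothAt.comp ?_ (matSmoothAt_iff.mp hg)
    rwa [hs] at hσ
  intro i j
  refine (h1 i j).congr_of_eventuallyEq ?_
  filter_upwards [hc.eventually hσ'] with w hw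
  rw [hs] at hw
  rw [hw]

/-- The matrix `√μ x^{-1/2}`, which normalizes `z` to `x = μ`. -/
def normalizer (μ : ℝ) (z : Mat p q) : Matrix (Fin p) (Fin p) ℂ :=
  (Real.sqrt μ : ℂ) • (gramSqrt z)⁻¹

variable {μ : ℝ}

theorem gramSqrt_mul_self (z : FullRank p q) : gramSqrt z.1 * gramSqrt z.1 = gram z :=
  CFC.sqrt_mul_sqrt_self _ (gram_posDef z).posSemidef.nonneg

theorem gramSqrt_posDef (z : FullRank p q) : (gramSqrt z.1).PosDef := sqrt_posDef (gram_posDef z)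

theorem normalizer_posDef (hμ : 0 < μ) (z : FullRank p q) : (normalizer μ z.1).PosDef :=
  (gramSqrt_posDef z).inv.smul (by simpa using hμ)

theorem matSmoothAt_normalizer (z : FullRank p q) :
    MatSmoothAt (fun w : Mat p q => normalizer μ w) z.1 :=
  MatSmoothAt.smul contDiffAt_const ((matSmoothAt_gramSqrt z).inv (gramSqrt_posDef z).det_pos.ne')

theorem normalizer_mul_gram_mul_normalizer (hμ : 0 < μ) (z : FullRank p q) :
    normalizer μ z.1 * gram z * normalizer μ z.1 = Matrix.scalar (Fin p) (μ : ℂ) := by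
  have h1 : IsUnit (gramSqrt z.1).det := (gramSqrt_posDef z).det_pos.ne'.isUnit
  have h2 : (Real.sqrt μ : ℂ) * Real.sqrt μ = μ := by
    rw [← Complex.ofReal_mul, Real.mul_self_sqrt hμ.le]
  rw [← gramSqrt_mul_self, normalizer, Matrix.smul_mul, Matrix.smul_mul, Matrix.mul_smul,
    smul_smul, h2, ← Matrix.mul_assoc, Matrix.nonsing_inv_mul _ h1, Matrix.one_mul,
    Matrix.mul_nonsing_inv _ h1]
  ext i j
  simp [Matrix.one_apply, Matrix.scalar_apply, Matrix.diagonal_apply]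

theorem normalizer_mul_normalizer_mul_gram (hμ : 0 < μ) (z : FullRank p q) :
    normalizer μ z.1 * normalizer μ z.1 * gram z = Matrix.scalar (Fin p) (μ : ℂ) := by
  have h1 : IsUnit (gramSqrt z.1).det := (gramSqrt_posDef z).det_pos.ne'.isUnit
  have h2 : (Real.sqrt μ : ℂ) * Real.sqrt μ = μ := by
    rw [← Complex.ofReal_mul, Real.mul_self_sqrt hμ.le]
  rw [← gramSqrt_mul_self, normalizer, Matrix.smul_mul, Matrix.smul_mul, Matrix.mul_smul,
    Matrix.smul_mul, smul_smul, h2, Matrix.mul_assoc,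
    ← Matrix.mul_assoc (gramSqrt z.1)⁻¹ (gramSqrt z.1), Matrix.nonsing_inv_mul _ h1,
    Matrix.one_mul, Matrix.nonsing_inv_mul _ h1]
  ext i j
  simp [Matrix.one_apply, Matrix.scalar_apply, Matrix.diagonal_apply]

theorem normalizer_act (U : Matrix.unitaryGroup (Fin p) ℂ) (z : FullRank p q) :
    normalizer μ (act z (unitaryGL U)).1 = U.1ᴴ * normalizer μ z.1 * U.1 := by
  have hU : U.1 * U.1ᴴ = 1 := Matrix.mem_unitaryGroup_iff.mp U.2
  have hU' : U.1ᴴ * U.1 = 1 := Matrix.mem_unitaryGroup_iff'.mp U.2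
  have h1 : gramSqrt (act z (unitaryGL U)).1 = U.1ᴴ * gramSqrt z.1 * U.1 := by
    refine CFC.sqrt_unique ?_ ?_
    · rw [xFun_act]
      calc _ = U.1ᴴ * gramSqrt z.1 * (U.1 * U.1ᴴ) * gramSqrt z.1 * U.1 := by
            simp only [Matrix.mul_assoc]
        _ = U.1ᴴ * (gramSqrt z.1 * gramSqrt z.1) * U.1 := by
            rw [hU, Matrix.mul_one]
            simp only [Matrix.mul_assoc]
        _ = _ := by
            rw [gramSqrt_mul_self]
            rfl
    · exact ((gramSqrt_posDef z).posSemidef.conjTranspose_mul_mul_same U.1).nonneg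
  rw [normalizer, normalizer, h1, Matrix.mul_inv_rev, Matrix.mul_inv_rev,
    Matrix.inv_eq_left_inv hU, Matrix.inv_eq_left_inv hU', Matrix.mul_smul, Matrix.smul_mul,
    Matrix.mul_assoc]

/-- The element of `GL(p, ℂ)` given by the normalizing matrix. -/
def normalizerGL (hμ : 0 < μ) (z : FullRank p q) : GL (Fin p) ℂ :=
  Matrix.GeneralLinearGroup.mkOfDetNeZero (normalizer μ z.1) (normalizer_posDef hμ z).det_pos.ne'

theorem normalizerGL_val (hμ : 0 < μ) (z : FullRank p q) :
    (normalizerGL hμ z).1 = normalizer μ z.1 := rfl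

theorem gram_act_normalizerGL (hμ : 0 < μ) (z : FullRank p q) :
    gram (act z (normalizerGL hμ z)) = Matrix.scalar (Fin p) (μ : ℂ) := by
  rw [gram, xFun_act, normalizerGL_val, (normalizer_posDef hμ z).isHermitian.eq]
  exact normalizer_mul_gram_mul_normalizer hμ z

/-- A homogeneous function which vanishes on the level set `x = μ` vanishes everywhere. -/
theorem eq_zero_of_homogeneous (hμ : 0 < μ) {f : SmoothFun p q} (hf : f ∈ homogeneousFun p q)
    (h0 : ∀ z, gram z = Matrix.scalar (Fin p) (μ : ℂ) → f.1 z = 0) : f = 0 := by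
  ext z
  rw [← hf (normalizerGL hμ z) z, h0 _ (gram_act_normalizerGL hμ z)]
  rfl

/-! ### Homogeneous series in the star ideal -/

theorem disjoint_Hom_starIdeal (hμ : 0 < μ) : Disjoint (Hom p q) (starIdeal p q μ) := by
  rw [Submodule.disjoint_def]
  intro H hH hI
  ext1 m
  rw [map_zero]
  exact eq_zero_of_homogeneous hμ (hH m) fun z hz => coeff_eq_zero_of_mem_starIdeal hH hI hz m

end SquareRoot

/-! ### Division of invariant functions by `x - μ` -/

section Division

open scoped ComplexOrder

variable {p q : ℕ} {μ : ℝ}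

theorem act_act (z : FullRank p q) (g h : GL (Fin p) ℂ) : act (act z g) h = act z (g * h) :=
  Subtype.ext (Matrix.mul_assoc (Matrix.of z.1) g.1 h.1)

/-- The homogeneous function which agrees with a given invariant function on the level set
`x = μ`. -/
def homogenize (hμ : 0 < μ) (f : SmoothFun p q) : SmoothFun p q :=
  ⟨fun z => f.1 (act z (normalizerGL hμ z)), by
    refine (contDiffOn_zeroExt_iff
      (g := fun z => zeroExt f.1 (Matrix.of.symm (Matrix.of z * normalizer μ z))) fun z =>
        (zeroExt_apply f.1 (act z (normalizerGL hμ z))).symm).mpr fun z hz => ?_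
    refine ContDiffAt.contDiffWithinAt ?_
    exact ContDiffAt.comp z (contDiffAt_zeroExt f (act ⟨z, hz⟩ (normalizerGL hμ ⟨z, hz⟩)))
      (matSmoothAt_iff.mp ((matSmoothAt_of z).mul (matSmoothAt_normalizer ⟨z, hz⟩)))⟩

theorem homogenize_mem (hμ : 0 < μ) {f : SmoothFun p q} (hf : f ∈ invariantFun p q) :
    homogenize hμ f ∈ homogeneousFun p q := by
  intro g z
  show f.1 (act (act z g) (normalizerGL hμ (act z g))) = f.1 (act z (normalizerGL hμ z))
  -- Both points lie on the level set `x = μ` and on the same orbit of `GL(p, ℂ)`.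
  let U : GL (Fin p) ℂ := (normalizerGL hμ z)⁻¹ * (g * normalizerGL hμ (act z g))
  have h1 : act (act z g) (normalizerGL hμ (act z g)) = act (act z (normalizerGL hμ z)) U := by
    rw [act_act, act_act]
    congr 1
    simp [U]
  have h2 := gram_act_normalizerGL hμ (act z g)
  have hμ' : (μ : ℂ) ≠ 0 := by exact_mod_cast hμ.ne'
  have h3 : U.1ᴴ * U.1 = 1 := by
    rw [h1, gram, xFun_act] at h2
    have h4 : (Matrix.of (act z (normalizerGL hμ z)).1)ᴴ *
        Matrix.of (act z (normalizerGL hμ z)).1 = Matrix.scalar (Fin p) (μ : ℂ) :=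
      gram_act_normalizerGL hμ z
    rw [h4, ← (Matrix.scalar_commute (μ : ℂ) (fun _ => mul_comm _ _) _).eq, Matrix.mul_assoc] at h2
    have h5 : Matrix.scalar (Fin p) ((μ : ℂ)⁻¹) * Matrix.scalar (Fin p) (μ : ℂ) = 1 := by
      rw [← map_mul, inv_mul_cancel₀ hμ', map_one]
    have h6 := congrArg (fun M => Matrix.scalar (Fin p) ((μ : ℂ)⁻¹) * M) h2
    simpa only [← Matrix.mul_assoc, h5, Matrix.one_mul] using h6
  have h7 : U = unitaryGL ⟨U.1, Matrix.mem_unitaryGroup_iff'.mpr h3⟩ := Units.ext rfl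
  rw [h1, h7]
  exact hf _ _

/-- The segment from the normalizing matrix `√μ x^{-1/2}` to the unit matrix. -/
def segment (μ t : ℝ) (z : Mat p q) : Matrix (Fin p) (Fin p) ℂ :=
  ((1 - t : ℝ) : ℂ) • normalizer μ z + (t : ℂ) • (1 : Matrix (Fin p) (Fin p) ℂ)

theorem segment_posDef (hμ : 0 < μ) {t : ℝ} (ht : t ∈ Set.Icc (0 : ℝ) 1) (z : FullRank p q) :
    (segment μ t z.1).PosDef := by
  rcases ht.2.eq_or_lt with rfl | h1
  · simpa [segment] using Matrix.PosDef.one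
  · refine Matrix.PosDef.add_posSemidef ((normalizer_posDef hμ z).smul ?_)
      (Matrix.PosSemidef.one.smul ?_)
    · exact_mod_cast sub_pos.mpr h1
    · exact_mod_cast ht.1

/-- The path from the normalization of `z` to `z`. -/
def normPath (μ t : ℝ) (z : Mat p q) : Mat p q :=
  Matrix.of.symm (Matrix.of z * segment μ t z)

theorem normPath_mem (hμ : 0 < μ) {t : ℝ} (ht : t ∈ Set.Icc (0 : ℝ) 1) (z : FullRank p q) :
    normPath μ t z.1 ∈ FullRank p q :=
  (act z (Matrix.GeneralLinearGroup.mkOfDetNeZero (segment μ t z.1)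
    (segment_posDef hμ ht z).det_pos.ne')).2

theorem normPath_one (z : Mat p q) : normPath μ 1 z = z := by
  simp [normPath, segment]

theorem normPath_zero (z : Mat p q) :
    normPath μ 0 z = Matrix.of.symm (Matrix.of z * normalizer μ z) := by
  simp [normPath, segment]

theorem hasDerivAt_normPath (t : ℝ) (z : Mat p q) :
    HasDerivAt (fun t => normPath μ t z)
      (Matrix.of.symm (Matrix.of z * (1 - normalizer μ z))) t := by
  have h : (fun t => normPath μ t z) = fun t : ℝ => normPath μ 0 z +
      t • Matrix.of.symm (Matrix.of z * (1 - normalizer μ z)) := by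
    ext t A j
    have h1 : normPath μ t z A j = (Matrix.of z * segment μ t z) A j := rfl
    have h2 : normPath μ 0 z A j = (Matrix.of z * normalizer μ z) A j := by
      rw [normPath_zero]
      rfl
    rw [Pi.add_apply, Pi.add_apply, h1, h2, Pi.smul_apply, Pi.smul_apply, Matrix.of_symm_apply,
      segment, Matrix.mul_add, Matrix.mul_smul, Matrix.mul_smul, Matrix.mul_sub]
    simp only [Matrix.add_apply, Matrix.smul_apply, Matrix.sub_apply, smul_eq_mul,
      Complex.real_smul]
    push_cast
    ring
  rw [h]
  simpa using ((hasDerivAt_id t).smul_const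
    (Matrix.of.symm (Matrix.of z * (1 - normalizer μ z)) : Mat p q)).const_add (normPath μ 0 z)

/-- The matrix `z (1 + √μ x^{-1/2})⁻¹ x⁻¹`. -/
def quotMat (μ : ℝ) (z : Mat p q) : Matrix (Fin (p + q)) (Fin p) ℂ :=
  Matrix.of z * ((1 + normalizer μ z)⁻¹ * ((Matrix.of z)ᴴ * Matrix.of z)⁻¹)

theorem one_add_normalizer_posDef (hμ : 0 < μ) (z : FullRank p q) :
    (1 + normalizer μ z.1).PosDef := Matrix.PosDef.one.add (normalizer_posDef hμ z)

/-- The velocity of the path is divisible by `x - μ`, because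
`(1 + s) (1 - s) = 1 - μ x⁻¹ = x⁻¹ (x - μ)` for `s = √μ x^{-1/2}`. -/
theorem quotMat_mul (hμ : 0 < μ) (z : FullRank p q) :
    quotMat μ z.1 * (gram z - Matrix.scalar (Fin p) (μ : ℂ)) =
      Matrix.of z.1 * (1 - normalizer μ z.1) := by
  have h1 : IsUnit (1 + normalizer μ z.1).det := (one_add_normalizer_posDef hμ z).det_pos.ne'.isUnit
  have h2 : IsUnit (gram z).det := (gram_posDef z).det_pos.ne'.isUnit
  have h3 : (gram z)⁻¹ * (gram z - Matrix.scalar (Fin p) (μ : ℂ)) =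
      (1 + normalizer μ z.1) * (1 - normalizer μ z.1) := by
    have h4 : (gram z)⁻¹ * Matrix.scalar (Fin p) (μ : ℂ) = normalizer μ z.1 * normalizer μ z.1 := by
      rw [← (Matrix.scalar_commute (μ : ℂ) (fun _ => mul_comm _ _) _).eq,
        ← normalizer_mul_normalizer_mul_gram hμ z, Matrix.mul_assoc, Matrix.mul_nonsing_inv _ h2,
        Matrix.mul_one]
    rw [Matrix.mul_sub, Matrix.nonsing_inv_mul _ h2, h4]
    noncomm_ring
  rw [quotMat, show (Matrix.of z.1)ᴴ * Matrix.of z.1 = gram z from rfl, Matrix.mul_assoc,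
    Matrix.mul_assoc, h3, ← Matrix.mul_assoc (1 + normalizer μ z.1)⁻¹, Matrix.nonsing_inv_mul _ h1,
    Matrix.one_mul]

/-- The matrix of holomorphic derivatives. -/
def dzMat (f : SmoothFun p q) (w : Mat p q) : Matrix (Fin p) (Fin (p + q)) ℂ :=
  Matrix.of fun a A => zeroExt (dz A a f).1 w

/-- The matrix of antiholomorphic derivatives. -/
def dzbarMat (f : SmoothFun p q) (w : Mat p q) : Matrix (Fin (p + q)) (Fin p) ℂ :=
  Matrix.of fun A b => zeroExt (dzbar A b f).1 w

/-- The quotient by `x - μ` of the derivative of `f` along the path. -/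
def quotIntegrand (μ : ℝ) (f : SmoothFun p q) (x : ℝ × Mat p q) : Matrix (Fin p) (Fin p) ℂ :=
  dzMat f (normPath μ x.1 x.2) * quotMat μ x.2 +
    (quotMat μ x.2)ᴴ * dzbarMat f (normPath μ x.1 x.2)

theorem matSmoothAt_segment (t : ℝ) (z : FullRank p q) :
    MatSmoothAt (fun x : ℝ × Mat p q => segment μ x.1 x.2) (t, z.1) := by
  refine MatSmoothAt.add (MatSmoothAt.smul ?_ (MatSmoothAt.comp (g := fun x : ℝ × Mat p q => x.2)
    (z := (t, z.1)) (matSmoothAt_normalizer z) contDiffAt_snd))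
    (MatSmoothAt.smul ?_ (MatSmoothAt.const _ _))
  · exact Complex.ofRealCLM.contDiff.contDiffAt.comp _ (contDiffAt_const.sub contDiffAt_fst)
  · exact Complex.ofRealCLM.contDiff.contDiffAt.comp _ contDiffAt_fst

theorem contDiffAt_normPath (t : ℝ) (z : FullRank p q) :
    ContDiffAt ℝ ∞ (fun x : ℝ × Mat p q => normPath μ x.1 x.2) (t, z.1) :=
  matSmoothAt_iff.mp ((MatSmoothAt.comp (g := fun x : ℝ × Mat p q => x.2)
    (z := (t, z.1)) (matSmoothAt_of z.1) contDiffAt_snd).mul (matSmoothAt_segment t z))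

theorem matSmoothAt_quotMat (hμ : 0 < μ) (z : FullRank p q) :
    MatSmoothAt (fun w : Mat p q => quotMat μ w) z.1 :=
  (matSmoothAt_of z.1).mul ((((MatSmoothAt.const 1 z.1).add (matSmoothAt_normalizer z)).inv
    (one_add_normalizer_posDef hμ z).det_pos.ne').mul
      (((matSmoothAt_of z.1).conjTranspose.mul (matSmoothAt_of z.1)).inv
        (gram_posDef z).det_pos.ne'))

theorem matSmoothAt_quotIntegrand (hμ : 0 < μ) (f : SmoothFun p q) {t : ℝ} {z : FullRank p q}
    (h : normPath μ t z.1 ∈ FullRank p q) : MatSmoothAt (quotIntegrand μ f) (t, z.1) := by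
  have hq : MatSmoothAt (fun x : ℝ × Mat p q => quotMat μ x.2) (t, z.1) :=
    MatSmoothAt.comp (g := fun x : ℝ × Mat p q => x.2) (z := (t, z.1))
      (matSmoothAt_quotMat hμ z) contDiffAt_snd
  refine MatSmoothAt.add (MatSmoothAt.mul (fun a A => ?_) hq)
    (hq.conjTranspose.mul fun A b => ?_)
  · exact ContDiffAt.comp (t, z.1) (contDiffAt_zeroExt (dz A a f) ⟨_, h⟩) (contDiffAt_normPath t z)
  · exact ContDiffAt.comp (t, z.1) (contDiffAt_zeroExt (dzbar A b f) ⟨_, h⟩)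
      (contDiffAt_normPath t z)

/-- The domain on which the path stays within the full rank matrices. -/
def pathDomain (p q : ℕ) (μ : ℝ) : Set (ℝ × Mat p q) :=
  (Set.univ ×ˢ FullRank p q) ∩ (fun x => normPath μ x.1 x.2) ⁻¹' FullRank p q

theorem isOpen_pathDomain : IsOpen (pathDomain p q μ) := by
  refine ContinuousOn.isOpen_inter_preimage (fun x hx => ?_)
    (isOpen_univ.prod (isOpen_fullRank p q)) (isOpen_fullRank p q)
  exact (contDiffAt_normPath x.1 ⟨x.2, hx.2⟩).continuousAt.continuousWithinAt

theorem Icc_prod_subset_pathDomain (hμ : 0 < μ) :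
    Set.Icc (0 : ℝ) 1 ×ˢ FullRank p q ⊆ pathDomain p q μ := fun x hx =>
  ⟨⟨trivial, hx.2⟩, normPath_mem hμ hx.1 ⟨x.2, hx.2⟩⟩

theorem contDiffOn_quotIntegrand (hμ : 0 < μ) (f : SmoothFun p q) (a b : Fin p) :
    ContDiffOn ℝ ∞ (fun x => quotIntegrand μ f x a b) (pathDomain p q μ) := fun x hx =>
  (matSmoothAt_quotIntegrand hμ f (t := x.1) (z := ⟨x.2, hx.1.2⟩) hx.2 a b).contDiffWithinAt

/-- The matrix `G` with `f - homogenize f = ∑ G_{ij} (x - μ)_{ji}`, obtained by integrating the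
derivative of `f` along the path from the normalization of `z` to `z`. -/
def divide (hμ : 0 < μ) (f : SmoothFun p q) : Matrix (Fin p) (Fin p) (SmoothFun p q) :=
  Matrix.of fun a b => ⟨fun z => ∫ t in (0 : ℝ)..1, quotIntegrand μ f (t, z.1) a b,
    (contDiffOn_zeroExt_iff (g := fun z => ∫ t in (0 : ℝ)..1, quotIntegrand μ f (t, z) a b)
      fun _ => rfl).mpr (contDiffOn_integral_param (isOpen_fullRank p q)
        (Icc_prod_subset_pathDomain hμ) isOpen_pathDomain (contDiffOn_quotIntegrand hμ f a b))⟩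

theorem divide_apply (hμ : 0 < μ) (f : SmoothFun p q) (a b : Fin p) (z : FullRank p q) :
    (divide hμ f a b).1 z = ∫ t in (0 : ℝ)..1, quotIntegrand μ f (t, z.1) a b := rfl

theorem continuousOn_quotIntegrand (hμ : 0 < μ) (f : SmoothFun p q) (a b : Fin p)
    (z : FullRank p q) :
    ContinuousOn (fun t => quotIntegrand μ f (t, z.1) a b) (Set.uIcc 0 1) :=
  continuousOn_slice (φ := fun x => quotIntegrand μ f x a b) (Icc_prod_subset_pathDomain hμ)
    (contDiffOn_quotIntegrand hμ f a b).continuousOn z.2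

/-- The derivative of `f` along the path, by `df(v) = tr(∂f v) + tr(v† ∂̄f)` and the divisibility of
the velocity `v` by the Hermitian matrix `x - μ`. -/
theorem fderiv_normPath_velocity (hμ : 0 < μ) (f : SmoothFun p q) {t : ℝ}
    (ht : t ∈ Set.Icc (0 : ℝ) 1) (z : FullRank p q) :
    fderiv ℝ (zeroExt f.1) (normPath μ t z.1)
        (Matrix.of.symm (Matrix.of z.1 * (1 - normalizer μ z.1))) =
      ∑ a, ∑ b, quotIntegrand μ f (t, z.1) a b * (xSub p q μ b a).1 z := by
  let w : FullRank p q := ⟨_, normPath_mem hμ ht z⟩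
  let J := gram z - Matrix.scalar (Fin p) (μ : ℂ)
  have hJ : Jᴴ = J := by
    rw [Matrix.conjTranspose_sub, (gram_posDef z).isHermitian.eq]
    congr 1
    simp [Matrix.scalar_apply, Matrix.diagonal_conjTranspose]
  set v : Mat p q := Matrix.of.symm (Matrix.of z.1 * (1 - normalizer μ z.1))
  have hv1 : Matrix.of v = quotMat μ z.1 * J := (quotMat_mul hμ z).symm
  have hv2 : (Matrix.of v)ᴴ = J * (quotMat μ z.1)ᴴ := by
    rw [hv1, Matrix.conjTranspose_mul, hJ]
  have h1 : fderiv ℝ (zeroExt f.1) (normPath μ t z.1) v = (dirDeriv v f).1 w := rfl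
  have h2 : (dirDeriv v f).1 w =
      (dzMat f w.1 * Matrix.of v).trace + ((Matrix.of v)ᴴ * dzbarMat f w.1).trace := by
    rw [dirDeriv_eq_sum_wirtinger]
    simp only [AddSubmonoidClass.coe_finsetSum, Finset.sum_apply, Subalgebra.coe_add,
      Subalgebra.coe_smul, Pi.add_apply, Pi.smul_apply, smul_eq_mul, Finset.sum_add_distrib,
      Matrix.trace, Matrix.diag_apply, Matrix.mul_apply, dzMat, dzbarMat, Matrix.of_apply,
      zeroExt_apply, Matrix.conjTranspose_apply]
    congr 1
    · rw [Finset.sum_comm]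
      simp only [mul_comm]
    · rw [Finset.sum_comm]
      rfl
  have h3 : ((Matrix.of v)ᴴ * dzbarMat f w.1).trace =
      ((quotMat μ z.1)ᴴ * dzbarMat f w.1 * J).trace := by
    rw [hv2, Matrix.mul_assoc, Matrix.trace_mul_comm]
  rw [h1, h2, h3, hv1, ← Matrix.mul_assoc, ← Matrix.trace_add, ← Matrix.add_mul]
  have h4 : ∀ b a, (xSub p q μ b a).1 z = J b a := fun b a =>
    congrFun (congrFun (xSub_val μ z) b) a
  simp only [h4]
  rfl

theorem sub_homogenize (hμ : 0 < μ) (f : SmoothFun p q) :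
    f - homogenize hμ f = ∑ a, ∑ b, divide hμ f a b * xSub p q μ b a := by
  ext z
  have hd : ∀ t ∈ Set.uIcc (0 : ℝ) 1, HasDerivAt (fun t => zeroExt f.1 (normPath μ t z.1))
      (∑ a, ∑ b, quotIntegrand μ f (t, z.1) a b * (xSub p q μ b a).1 z) t := fun t ht => by
    rw [Set.uIcc_of_le zero_le_one] at ht
    rw [← fderiv_normPath_velocity hμ f ht z]
    exact (differentiableAt_zeroExt f ⟨_, normPath_mem hμ ht z⟩).hasFDerivAt.comp_hasDerivAt t
      (hasDerivAt_normPath t z.1)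
  have hc : ∀ a b, ContinuousOn (fun t => quotIntegrand μ f (t, z.1) a b * (xSub p q μ b a).1 z)
      (Set.uIcc 0 1) := fun a b => (continuousOn_quotIntegrand hμ f a b z).mul continuousOn_const
  have h1 := intervalIntegral.integral_eq_sub_of_hasDerivAt hd
    (ContinuousOn.intervalIntegrable (continuousOn_finsetSum _ fun a _ =>
      continuousOn_finsetSum _ fun b _ => hc a b))
  rw [intervalIntegral.integral_finsetSum fun a _ => ContinuousOn.intervalIntegrable
    (continuousOn_finsetSum _ fun b _ => hc a b)] at h1
  simp only [intervalIntegral.integral_finsetSum fun b _ => (hc _ b).intervalIntegrable,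
    intervalIntegral.integral_mul_const, ← divide_apply hμ] at h1
  rw [normPath_one, zeroExt_apply, normPath_zero] at h1
  have h2 : zeroExt f.1 (Matrix.of.symm (Matrix.of z.1 * normalizer μ z.1)) =
      (homogenize hμ f).1 z := zeroExt_apply f.1 (act z (normalizerGL hμ z))
  rw [h2] at h1
  simpa using h1.symm

theorem dzMat_act {f : SmoothFun p q} (hf : f ∈ invariantFun p q)
    (U : Matrix.unitaryGroup (Fin p) ℂ) (w : FullRank p q) :
    dzMat f (act w (unitaryGL U)).1 = U.1ᴴ * dzMat f w.1 := by
  have hU' : U.1ᴴ * U.1 = 1 := Matrix.mem_unitaryGroup_iff'.mp U.2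
  have h : dzMat f w.1 = U.1 * dzMat f (act w (unitaryGL U)).1 := by
    ext i A
    simp only [dzMat, Matrix.mul_apply, Matrix.of_apply, zeroExt_apply]
    conv_lhs => rw [← mem_invariantFun_iff.mp hf U, dz_pull]
    simp [pull_apply]
  rw [h, ← Matrix.mul_assoc, hU', Matrix.one_mul]

theorem dzbarMat_act {f : SmoothFun p q} (hf : f ∈ invariantFun p q)
    (U : Matrix.unitaryGroup (Fin p) ℂ) (w : FullRank p q) :
    dzbarMat f (act w (unitaryGL U)).1 = dzbarMat f w.1 * U.1 := by
  have hU' : U.1ᴴ * U.1 = 1 := Matrix.mem_unitaryGroup_iff'.mp U.2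
  have h : dzbarMat f w.1 = dzbarMat f (act w (unitaryGL U)).1 * U.1ᴴ := by
    ext A i
    simp only [dzbarMat, Matrix.mul_apply, Matrix.of_apply, zeroExt_apply,
      Matrix.conjTranspose_apply]
    conv_lhs => rw [← mem_invariantFun_iff.mp hf U, dzbar_pull]
    simp [pull_apply, mul_comm]
  rw [h, Matrix.mul_assoc, hU', Matrix.mul_one]

theorem normPath_act (U : Matrix.unitaryGroup (Fin p) ℂ) (t : ℝ) (z : FullRank p q) :
    normPath μ t (act z (unitaryGL U)).1 = rightMul U.1 (normPath μ t z.1) := by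
  have hU : U.1 * U.1ᴴ = 1 := Matrix.mem_unitaryGroup_iff.mp U.2
  have hU' : U.1ᴴ * U.1 = 1 := Matrix.mem_unitaryGroup_iff'.mp U.2
  have h1 : segment μ t (act z (unitaryGL U)).1 = U.1ᴴ * segment μ t z.1 * U.1 := by
    rw [segment, segment, normalizer_act, Matrix.mul_add, Matrix.add_mul, Matrix.mul_smul,
      Matrix.smul_mul, Matrix.mul_smul, Matrix.smul_mul, Matrix.mul_one, hU']
  show Matrix.of.symm (Matrix.of z.1 * U.1 * segment μ t (act z (unitaryGL U)).1) =
    Matrix.of.symm (Matrix.of z.1 * segment μ t z.1 * U.1)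
  rw [h1, Matrix.mul_assoc, ← Matrix.mul_assoc U.1, ← Matrix.mul_assoc U.1, hU, Matrix.one_mul,
    Matrix.mul_assoc]

theorem quotMat_act (U : Matrix.unitaryGroup (Fin p) ℂ) (z : FullRank p q) :
    quotMat μ (act z (unitaryGL U)).1 = quotMat μ z.1 * U.1 := by
  have hU : U.1 * U.1ᴴ = 1 := Matrix.mem_unitaryGroup_iff.mp U.2
  have hU' : U.1ᴴ * U.1 = 1 := Matrix.mem_unitaryGroup_iff'.mp U.2
  have hinv : ∀ M : Matrix (Fin p) (Fin p) ℂ, (U.1ᴴ * M * U.1)⁻¹ = U.1ᴴ * M⁻¹ * U.1 := fun M => by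
    rw [Matrix.mul_inv_rev, Matrix.mul_inv_rev, Matrix.inv_eq_left_inv hU,
      Matrix.inv_eq_left_inv hU', Matrix.mul_assoc]
  have h1 : 1 + normalizer μ (act z (unitaryGL U)).1 = U.1ᴴ * (1 + normalizer μ z.1) * U.1 := by
    rw [normalizer_act, Matrix.mul_add, Matrix.add_mul, Matrix.mul_one, hU']
  have h2 : (Matrix.of (act z (unitaryGL U)).1)ᴴ * Matrix.of (act z (unitaryGL U)).1 =
      U.1ᴴ * ((Matrix.of z.1)ᴴ * Matrix.of z.1) * U.1 := xFun_act _ z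
  have h3 : Matrix.of (act z (unitaryGL U)).1 = Matrix.of z.1 * U.1 := rfl
  rw [quotMat, h2, h1, hinv, hinv, h3, quotMat]
  generalize (1 + normalizer μ z.1)⁻¹ = M
  generalize ((Matrix.of z.1)ᴴ * Matrix.of z.1)⁻¹ = N
  calc _ = Matrix.of z.1 * ((U.1 * U.1ᴴ) * M * (U.1 * U.1ᴴ) * N) * U.1 := by
        simp only [Matrix.mul_assoc]
    _ = _ := by rw [hU, Matrix.one_mul, Matrix.mul_one]

theorem quotIntegrand_act (hμ : 0 < μ) {f : SmoothFun p q} (hf : f ∈ invariantFun p q)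
    (U : Matrix.unitaryGroup (Fin p) ℂ) {t : ℝ} (ht : t ∈ Set.Icc (0 : ℝ) 1) (z : FullRank p q) :
    quotIntegrand μ f (t, (act z (unitaryGL U)).1) =
      U.1ᴴ * quotIntegrand μ f (t, z.1) * U.1 := by
  let w : FullRank p q := ⟨_, normPath_mem hμ ht z⟩
  have h1 : normPath μ t (act z (unitaryGL U)).1 = (act w (unitaryGL U)).1 := normPath_act U t z
  simp only [quotIntegrand, h1, dzMat_act hf, dzbarMat_act hf, quotMat_act, Matrix.mul_add,
    Matrix.add_mul, Matrix.conjTranspose_mul, Matrix.mul_assoc]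
  rfl

theorem pull_divide (hμ : 0 < μ) {f : SmoothFun p q} (hf : f ∈ invariantFun p q)
    (U : Matrix.unitaryGroup (Fin p) ℂ) (i j : Fin p) :
    pull (unitaryGL U) (divide hμ f i j) = ∑ k, ∑ l,
      ((U⁻¹ : Matrix.unitaryGroup (Fin p) ℂ).1 i k * U.1 l j) • divide hμ f k l := by
  ext z
  rw [pull_apply, divide_apply]
  have h1 : ∀ t ∈ Set.uIcc (0 : ℝ) 1, quotIntegrand μ f (t, (act z (unitaryGL U)).1) i j =
      ∑ k, ∑ l, ((U⁻¹ : Matrix.unitaryGroup (Fin p) ℂ).1 i k * U.1 l j) *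
        quotIntegrand μ f (t, z.1) k l := fun t ht => by
    rw [Set.uIcc_of_le zero_le_one] at ht
    rw [quotIntegrand_act hμ hf U ht]
    simp only [Matrix.mul_apply, Finset.sum_mul]
    rw [Finset.sum_comm]
    refine Finset.sum_congr rfl fun k _ => Finset.sum_congr rfl fun l _ => ?_
    rw [show (U⁻¹ : Matrix.unitaryGroup (Fin p) ℂ).1 = U.1ᴴ from rfl]
    ring
  have hc : ∀ k l, ContinuousOn (fun t => ((U⁻¹ : Matrix.unitaryGroup (Fin p) ℂ).1 i k * U.1 l j) *
      quotIntegrand μ f (t, z.1) k l) (Set.uIcc 0 1) := fun k l =>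
    continuousOn_const.mul (continuousOn_quotIntegrand hμ f k l z)
  rw [intervalIntegral.integral_congr h1,
    intervalIntegral.integral_finsetSum fun a _ => ContinuousOn.intervalIntegrable
      (continuousOn_finsetSum _ fun b _ => hc a b)]
  simp only [intervalIntegral.integral_finsetSum fun b _ => (hc _ b).intervalIntegrable,
    intervalIntegral.integral_const_mul, ← divide_apply hμ]
  simp

end Division

/-! ### The reduction of invariant series -/

section Reduction

variable {p q : ℕ} {μ : ℝ}

theorem Hom_le_Inv : Hom p q ≤ Inv p q := fun _ hF n U z => hF n (unitaryGL U) z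

/-- The coefficient of `λ` of the pairing of a matrix of smooth functions with `x - μ`. -/
def eulerTrace (G : Matrix (Fin p) (Fin p) (SmoothFun p q)) : SmoothFun p q :=
  ∑ i, ∑ j, euler i j (G i j)

/-- The parts of an invariant series which remain to be reduced: dividing the coefficient of `λ^n`
by `x - μ` leaves a first order term that is carried over to the coefficient of `λ^(n+1)`. -/
def remainder (hμ : 0 < μ) (F : Series p q) : ℕ → SmoothFun p q
  | 0 => PowerSeries.coeff 0 F
  | n + 1 => PowerSeries.coeff (n + 1) F - eulerTrace (divide hμ (remainder hμ F n))

theorem eulerTrace_divide_mem (hμ : 0 < μ) {f : SmoothFun p q} (hf : f ∈ invariantFun p q) :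
    eulerTrace (divide hμ f) ∈ invariantFun p q := by
  have h : (Matrix.of fun i j => PowerSeries.C (divide hμ f i j)) ∈ Equivariant p q := by
    rw [mem_Equivariant_iff]
    intro U i j
    ext1 n
    simp only [coeff_pullSeries, map_sum, coeff_C_smul, Matrix.of_apply, PowerSeries.coeff_C]
    split_ifs
    · exact pull_divide hμ hf U i j
    · simp
  have h1 := pairing_mem_Inv μ h 1
  rw [coeff_succ_pairing] at h1
  simpa [PowerSeries.coeff_C, eulerTrace] using h1

theorem remainder_mem (hμ : 0 < μ) {F : Series p q} (hF : F ∈ Inv p q) (n : ℕ) :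
    remainder hμ F n ∈ invariantFun p q := by
  induction n with
  | zero => exact hF 0
  | succ n ih => exact Submodule.sub_mem _ (hF (n + 1)) (eulerTrace_divide_mem hμ ih)

theorem Hom_sup_starIdeal (hμ : 0 < μ) : Hom p q ⊔ starIdeal p q μ = Inv p q := by
  refine le_antisymm (sup_le Hom_le_Inv (starIdeal_le_Inv μ)) fun F hF => ?_
  rw [Submodule.mem_sup]
  let G : Matrix (Fin p) (Fin p) (Series p q) :=
    Matrix.of fun i j => PowerSeries.mk fun n => divide hμ (remainder hμ F n) i j
  have hG : G ∈ Equivariant p q := by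
    rw [mem_Equivariant_iff]
    intro U i j
    ext1 n
    simp only [coeff_pullSeries, map_sum, coeff_C_smul, G, Matrix.of_apply, PowerSeries.coeff_mk]
    exact pull_divide hμ (remainder_mem hμ hF n) U i j
  refine ⟨PowerSeries.mk fun n => homogenize hμ (remainder hμ F n), fun n => ?_,
    pairing p q μ G, Submodule.mem_map_of_mem hG, ?_⟩
  · rw [PowerSeries.coeff_mk]
    exact homogenize_mem hμ (remainder_mem hμ hF n)
  ext1 n
  rw [map_add, PowerSeries.coeff_mk]
  cases n with
  | zero =>
    simp only [coeff_zero_pairing, G, Matrix.of_apply, PowerSeries.coeff_mk]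
    rw [← sub_homogenize]
    simp [remainder]
  | succ n =>
    simp only [coeff_succ_pairing, G, Matrix.of_apply, PowerSeries.coeff_mk,
      Finset.sum_add_distrib]
    rw [← sub_homogenize, remainder, eulerTrace]
    abel

end Reduction

/-! ### The projection of a direct sum -/

/-- A direct sum decomposition of a submodule gives exactly one projection onto the first summand
with kernel the second one. -/
theorem existsUnique_projection {R M : Type*} [Ring R] [AddCommGroup M] [Module R M]
    {N A B : Submodule R M} (hAB : A ⊔ B = N) (hd : Disjoint A B) :
    ∃! P : N →ₗ[R] A, (∀ x : N, (x : M) ∈ A → (P x : M) = x) ∧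
      ∀ x : N, P x = 0 ↔ (x : M) ∈ B := by
  have hA : A ≤ N := hAB ▸ le_sup_left
  have hB : B ≤ N := hAB ▸ le_sup_right
  have hc : IsCompl (A.submoduleOf N) (B.submoduleOf N) := by
    refine ⟨Submodule.disjoint_def.mpr fun x hx hy => Subtype.ext ?_,
      codisjoint_iff_le_sup.mpr fun x _ => ?_⟩
    · exact Submodule.disjoint_def.mp hd x hx hy
    · obtain ⟨a, ha, b, hb, hx⟩ := Submodule.mem_sup.mp (hAB.ge x.2)
      exact Submodule.mem_sup.mpr ⟨⟨a, hA ha⟩, ha, ⟨b, hB hb⟩, hb, Subtype.ext hx⟩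
  refine existsUnique_of_exists_of_unique
    ⟨(Submodule.submoduleOfEquivOfLe hA).toLinearMap ∘ₗ Submodule.projectionOnto _ _ hc,
      fun x hx => ?_, fun x => ?_⟩ ?_
  · exact congrArg (fun y : A.submoduleOf N => ((y : N) : M))
      (Submodule.projectionOnto_apply_left hc ⟨x, hx⟩)
  · rw [LinearMap.comp_apply, LinearEquiv.coe_coe, LinearEquiv.map_eq_zero_iff,
      Submodule.projectionOnto_apply_eq_zero_iff]
    rfl
  · rintro P Q ⟨hP, hP'⟩ ⟨hQ, hQ'⟩
    ext x
    obtain ⟨a, ha, b, hb, hx⟩ := Submodule.mem_sup.mp (hAB.ge x.2)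
    have h1 : x = ⟨a, hA ha⟩ + ⟨b, hB hb⟩ := Subtype.ext hx.symm
    rw [h1, map_add, map_add, (hP' ⟨b, hB hb⟩).mpr hb, (hQ' ⟨b, hB hb⟩).mpr hb, add_zero,
      add_zero, hP ⟨a, hA ha⟩ ha, hQ ⟨a, hA ha⟩ ha]

end WickGrassmann

end

open WickGrassmann in
theorem mainTheorem2 (p q : ℕ) (μ : ℝ) (hμ : 0 < μ) :
    -- the invariant series are closed under the Wick product
    (∀ F ∈ Inv p q, ∀ G ∈ Inv p q, wick F G ∈ Inv p q) ∧
    -- the star ideal is a two-sided ideal of invariant series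
    starIdeal p q μ ≤ Inv p q ∧
    (∀ F ∈ Inv p q, ∀ K ∈ starIdeal p q μ,
      wick F K ∈ starIdeal p q μ ∧ wick K F ∈ starIdeal p q μ) ∧
    -- the invariant series are the direct sum of homogeneous series and star ideal
    Hom p q ≤ Inv p q ∧
    Hom p q ⊔ starIdeal p q μ = Inv p q ∧
    Disjoint (Hom p q) (starIdeal p q μ) ∧
    -- there is exactly one projection onto the homogeneous series with kernel the star ideal
    (∃! P : Inv p q →ₗ[PowerSeries ℂ] Hom p q,
      (∀ F : Inv p q, (F : Series p q) ∈ Hom p q → (P F : Series p q) = F) ∧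
      ∀ F : Inv p q, P F = 0 ↔ (F : Series p q) ∈ starIdeal p q μ) := by
  exact ⟨fun _ hF _ hG => wick_mem_Inv hF hG, starIdeal_le_Inv μ,
    fun _ hF _ hK => ⟨wick_mem_starIdeal μ hF hK, wick_mem_starIdeal' μ hF hK⟩, Hom_le_Inv,
    Hom_sup_starIdeal hμ, disjoint_Hom_starIdeal hμ,
    existsUnique_projection (Hom_sup_starIdeal hμ) (disjoint_Hom_starIdeal hμ)⟩
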